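/- Let $p$ be a prime, let $K/\mathbb{Q}_p$ be a finite extension with absolute Galois group $G_K=\operatorname{Gal}(\overline{K}/K)$, and let $\overline{\mathbb{F}}_p(1)$ be the one-dimensional $\overline{\mathbb{F}}_p$-vector space $\overline{\mathbb{F}}_p$ on which $G_K$ acts through the mod $p$ cyclotomic character. Let $\pi$ be a uniformiser of $K$, let $(\pi^{1/p^n})_{n\ge 0}$ be a compatible system of $p$-power roots of $\pi$ in $\overline{K}$ (so $\pi^{1/p^0}=\pi$ and $(\pi^{1/p^{n+1}})^p=\pi^{1/p^n}$), put $K_\infty=K(\pi^{1/p^\infty})=\bigcup_n K(\pi^{1/p^n})$, and let $G_{K_\infty}=\operatorname{Gal}(\overline{K}/K_\infty)\subset G_K$. A continuous representation $V$ of $G_K$ on a finite-dimensional $\overline{\mathbb{F}}_p$-vector space (with $\overline{\mathbb{F}}_p$ discrete) is called cyclotomic-free if it admits a composition series $0=V_n\subset\dots\subset V_1\subset V_0=V$ by subrepresentations such that, for every $0\le i<n$, the representation $(V_i/V_{i+1})\otimes_{\overline{\mathbb{F}}_p}\overline{\mathbb{F}}_p(1)$ is not a Jordan–Hölder factor of $V_{i+1}$.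 Theorem. Let $V$ and $W$ be cyclotomic-free continuous representations of $G_K$ on finite-dimensional $\overline{\mathbb{F}}_p$-vector spaces, and let $f\colon V\to W$ be a $G_{K_\infty}$-equivariant $\overline{\mathbb{F}}_p$-linear map. Then $f$ is $G_K$-equivariant. -/

import Mathlib

noncomputable section

namespace CycFree

section Rep

variable {k G V : Type*} [Field k] [Group G] [AddCommGroup V] [Module k V]

/-- For subrepresentations `A ≤ B` of `ρ`, the quotient representation `B / A`
(in general this is `B / (A ∩ B)`; it is only used for `A ≤ B`). -/
def subquotient {ρ : Representation k G V} (A B : Subrepresentation ρ) :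
    Representation k G (B.toSubmodule ⧸ A.toSubmodule.submoduleOf B.toSubmodule) :=
  B.toRepresentation.quotient (A.toSubmodule.submoduleOf B.toSubmodule)
    (fun g _ hv => A.apply_mem_toSubmodule g hv)

/-- A composition series `0 = V_n ⊂ ⋯ ⊂ V_1 ⊂ V_0 = V` of a representation: a decreasing chain of
subrepresentations, all of whose successive quotients `V_i / V_{i+1}` are irreducible. -/
structure CompSeries (ρ : Representation k G V) where
  /-- the number `n` of steps -/
  length : ℕ
  /-- the subrepresentations `V_i` -/
  sub : Fin (length + 1) → Subrepresentation ρ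
  sub_zero : sub 0 = ⊤
  sub_last : sub (Fin.last length) = ⊥
  le : ∀ i : Fin length, sub i.succ ≤ sub i.castSucc
  irreducible : ∀ i : Fin length, (subquotient (sub i.succ) (sub i.castSucc)).IsIrreducible

/-- The representation `V_i / V_{i+1}`. -/
abbrev CompSeries.factor {ρ : Representation k G V} (s : CompSeries ρ) (i : Fin s.length) :=
  subquotient (s.sub i.succ) (s.sub i.castSucc)

/-- `σ` is a Jordan-Hölder factor of `ρ`: it is isomorphic to a successive quotient of a
composition series of `ρ`. -/
def IsJHFactor {U : Type*} [AddCommGroup U] [Module k U]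
    (σ : Representation k G U) (ρ : Representation k G V) : Prop :=
  ∃ (s : CompSeries ρ) (i : Fin s.length), Nonempty (σ.Equiv (s.factor i))

end Rep

section Galois

variable (p : ℕ) [Fact p.Prime] (K : Type*) [Field K] [Algebra ℚ_[p] K]

/-- `G_K`, the absolute Galois group of `K`, with its Krull topology. -/
abbrev GK (K : Type*) [Field K] := Gal(AlgebraicClosure K/K)

/-- `\overline{𝔽}_p`. -/
abbrev Fbar (p : ℕ) [Fact p.Prime] := AlgebraicClosure (ZMod p)

theorem card_rootsOfUnity_algebraicClosure :
    Nat.card (rootsOfUnity p (AlgebraicClosure K)) = p := by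
  have : CharZero (AlgebraicClosure K) := charZero_of_injective_algebraMap
    ((algebraMap K (AlgebraicClosure K)).comp (algebraMap ℚ_[p] K)).injective
  exact HasEnoughRootsOfUnity.natCard_rootsOfUnity _ p

/-- The mod `p` cyclotomic character of `G_K`: `g ζ = ζ ^ χ(g)` for all `ζ` with `ζ ^ p = 1`. -/
def cyc : GK K →* (ZMod p)ˣ :=
  (modularCyclotomicCharacter (AlgebraicClosure K)
    (card_rootsOfUnity_algebraicClosure p K)).comp
    (MulSemiringAction.toRingAut (GK K) (AlgebraicClosure K))

/-- `\overline{𝔽}_p(1)`: the line `\overline{𝔽}_p` on which `G_K` acts through the mod `p`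
cyclotomic character. -/
def Fbar1 : Representation (Fbar p) (GK K) (Fbar p) :=
  (Algebra.lmul (Fbar p) (Fbar p) : Fbar p →* Module.End (Fbar p) (Fbar p)).comp
    ((algebraMap (ZMod p) (Fbar p) : ZMod p →* Fbar p).comp ((Units.coeHom (ZMod p)).comp (cyc p K)))

/-- A representation of `G_K` over `\overline{𝔽}_p` is cyclotomic-free if it has a composition
series `(V_i)` such that, for every `i`, the representation `V_i / V_{i+1} ⊗ \overline{𝔽}_p(1)` is
not a Jordan-Hölder factor of `V_{i+1}`. -/
def IsCyclotomicFree {V : Type*} [AddCommGroup V] [Module (Fbar p) V]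
    (ρ : Representation (Fbar p) (GK K) V) : Prop :=
  ∃ s : CompSeries ρ, ∀ i : Fin s.length,
    ¬ IsJHFactor ((s.factor i).tprod (Fbar1 p K)) (s.sub i.succ).toRepresentation

/-- `K_∞ = K(π^{1/p^∞})`, for a system `ϖ n = π^{1/p^n}` of elements of the algebraic closure. -/
def Kinf {K : Type*} [Field K] (ϖ : ℕ → AlgebraicClosure K) :
    IntermediateField K (AlgebraicClosure K) :=
  IntermediateField.adjoin K (Set.range ϖ)

/-- `G_{K_∞}`, as a subgroup of `G_K`. -/
def GKinf {K : Type*} [Field K] (ϖ : ℕ → AlgebraicClosure K) : Subgroup (GK K) :=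
  (Kinf ϖ).fixingSubgroup

end Galois

end CycFree

end

/-!
Put `H n = Gal(K̄ / K(π^{1/p^n}))` and let `P ⊆ G_K` be the preimage of the wild inertia of a finite
normal extension `L / K` through which both representations factor and which contains the `p`-th
roots of unity and enough of the `π^{1/p^n}`. The wild inertia is a `p`-group, so `P` acts trivially
on every simple subquotient of a representation in characteristic `p`.

Comparing `p ^ n` with ramification indices shows that each `H (n + 1) ⊂ H n` is strict on `P`: some
`x ∈ P ∩ H n` moves `π^{1/p^{n+1}}`. Then `G_K = P H n`, the group `H n` is the union of the cosets
`x ^ j H (n + 1)`, and modulo `H (n + 1)` conjugation by `g ∈ H n` raises `x` to the power `χ(g)`.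
Hence if `A` and `B` are representations of `G_K` on which `P` is trivial, the value at `x` of a
`Hom(A, B)`-valued cocycle of `G_K` vanishing on `H (n + 1)` but not on `H n` is a nonzero
`G_K`-equivariant map `A ⊗ χ → B`. Cyclotomic-freeness excludes such maps. By dévissage along
composition series, `G_{K_∞}`-stable subspaces of `W` are `G_K`-stable, so `f` maps composition
series to composition series, and then the cocycle `g ↦ g f g⁻¹ - f` vanishes.
-/

noncomputable section

namespace CycFree

section Lattice

theorem isSimpleOrder_Icc_iff_covBy {α : Type*} [PartialOrder α] {a b : α} [Fact (a ≤ b)] :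
    IsSimpleOrder (Set.Icc a b) ↔ a ⋖ b := by
  have hab : a ≤ b := Fact.out
  constructor
  · intro h
    refine ⟨hab.lt_of_ne fun he => ?_, fun c hac hcb => ?_⟩
    · exact bot_ne_top (α := Set.Icc a b) (Subtype.ext he)
    · rcases eq_bot_or_eq_top (⟨c, hac.le, hcb.le⟩ : Set.Icc a b) with hc | hc
      · exact hac.ne' (congrArg Subtype.val hc)
      · exact hcb.ne (congrArg Subtype.val hc)
  · intro h
    refine { exists_pair_ne := ⟨⊥, ⊤, fun he => h.ne (congrArg Subtype.val he)⟩,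
             eq_bot_or_eq_top := fun c => ?_ }
    exact (h.eq_or_eq c.2.1 c.2.2).imp Subtype.ext Subtype.ext

variable {k G V W A : Type*} [Field k] [Group G] [AddCommGroup V] [Module k V]
  [AddCommGroup W] [Module k W] [AddCommGroup A] [Module k A]
  {ρ : Representation k G V} {τ : Representation k G W} {β : Representation k G A}

theorem strictMono_toSubmodule :
    StrictMono (Subrepresentation.toSubmodule : Subrepresentation ρ → Submodule k V) :=
  fun _ _ h => h

instance [FiniteDimensional k V] : WellFoundedLT (Subrepresentation ρ) :=
  strictMono_toSubmodule.wellFoundedLT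

instance [FiniteDimensional k V] : WellFoundedGT (Subrepresentation ρ) :=
  strictMono_toSubmodule.wellFoundedGT

/-- The image of a subrepresentation under an intertwining map. -/
def mapSub (f : ρ.IntertwiningMap τ) (X : Subrepresentation ρ) : Subrepresentation τ where
  toSubmodule := X.toSubmodule.map f.toLinearMap
  apply_mem_toSubmodule g := by
    rintro _ ⟨v, hv, rfl⟩
    exact ⟨ρ g v, X.apply_mem_toSubmodule g hv, f.isIntertwining _ _ g v⟩

/-- The preimage of a subrepresentation under an intertwining map. -/
def comapSub (f : ρ.IntertwiningMap τ) (Z : Subrepresentation τ) : Subrepresentation ρ where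
  toSubmodule := Z.toSubmodule.comap f.toLinearMap
  apply_mem_toSubmodule g v hv := by
    simpa [f.isIntertwining] using Z.apply_mem_toSubmodule g hv

/-- The inclusion of a subrepresentation, as an intertwining map. -/
def subtypeMap (X : Subrepresentation ρ) : X.toRepresentation.IntertwiningMap ρ where
  toLinearMap := X.toSubmodule.subtype
  isIntertwining' _ := rfl

/-- The inclusion of a subrepresentation into a larger one, as an intertwining map. -/
def inclusionMap {X T : Subrepresentation ρ} (h : X ≤ T) :
    X.toRepresentation.IntertwiningMap T.toRepresentation where
  toLinearMap := Submodule.inclusion (p := X.toSubmodule) (p' := T.toSubmodule) h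
  isIntertwining' _ := rfl

/-- The projection of `X` onto `X / Y`, as an intertwining map. -/
def mkMap (Y X : Subrepresentation ρ) : X.toRepresentation.IntertwiningMap (subquotient Y X) where
  toLinearMap := Submodule.mkQ _
  isIntertwining' _ := rfl

theorem mkMap_surjective (Y X : Subrepresentation ρ) : Function.Surjective (mkMap Y X) :=
  Submodule.mkQ_surjective _

theorem mkMap_eq_zero_iff {Y X : Subrepresentation ρ} {v : X.toSubmodule} :
    mkMap Y X v = 0 ↔ (v : V) ∈ Y :=
  Submodule.Quotient.mk_eq_zero (Y.toSubmodule.submoduleOf X.toSubmodule)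

theorem mkMap_eq_iff {Y X : Subrepresentation ρ} {v w : X.toSubmodule} :
    mkMap Y X v = mkMap Y X w ↔ (v - w : V) ∈ Y :=
  Submodule.Quotient.eq (Y.toSubmodule.submoduleOf X.toSubmodule)

/-- The correspondence between subrepresentations of `X / Y` and subrepresentations lying between
`Y` and `X`. -/
def subquotientOrderIso {Y X : Subrepresentation ρ} (h : Y ≤ X) :
    Subrepresentation (subquotient Y X) ≃o Set.Icc Y X where
  toFun Z := ⟨mapSub (subtypeMap X) (comapSub (mkMap Y X) Z),
    fun v hv => ⟨⟨v, h hv⟩, by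
      change mkMap Y X _ ∈ Z
      rw [mkMap_eq_zero_iff.2 hv]
      exact Z.toSubmodule.zero_mem, rfl⟩,
    Submodule.map_subtype_le _ _⟩
  invFun Z := mapSub (mkMap Y X) (comapSub (subtypeMap X) Z)
  left_inv Z := Subrepresentation.toSubmodule_injective <| by
    change ((((Z.toSubmodule.comap (Submodule.mkQ _)).map X.toSubmodule.subtype).comap
      X.toSubmodule.subtype)).map (Submodule.mkQ _) = _
    rw [Submodule.comap_map_eq_of_injective X.toSubmodule.injective_subtype,
      Submodule.map_comap_eq_of_surjective (Submodule.mkQ_surjective _)]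
  right_inv Z := Subtype.ext <| Subrepresentation.toSubmodule_injective <| by
    change (((Z.1.toSubmodule.comap X.toSubmodule.subtype).map (Submodule.mkQ
      (Y.toSubmodule.comap X.toSubmodule.subtype))).comap (Submodule.mkQ _)).map
        X.toSubmodule.subtype = _
    rw [Submodule.comap_map_mkQ, sup_eq_right.2 (Submodule.comap_mono (show Y.toSubmodule ≤ _ from
      Z.2.1)), Submodule.map_comap_subtype, inf_eq_right.2 (show Z.1.toSubmodule ≤ _ from Z.2.2)]
  map_rel_iff' {Z Z'} :=
    (Submodule.map_le_map_iff_of_injective X.toSubmodule.injective_subtype _ _).trans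
      (Submodule.comap_le_comap_iff_of_surjective (Submodule.mkQ_surjective _))

theorem isIrreducible_subquotient_iff {Y X : Subrepresentation ρ} (h : Y ≤ X) :
    (subquotient Y X).IsIrreducible ↔ Y ⋖ X :=
  have : Fact (Y ≤ X) := ⟨h⟩
  (subquotientOrderIso h).isSimpleOrder_iff.trans isSimpleOrder_Icc_iff_covBy

theorem CompSeries.covBy (s : CompSeries ρ) (i : Fin s.length) :
    s.sub i.succ ⋖ s.sub i.castSucc :=
  (isIrreducible_subquotient_iff (s.le i)).1 (s.irreducible i)

theorem isIrreducible_of_equiv (e : β.Equiv τ) [hτ : τ.IsIrreducible] : β.IsIrreducible := by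
  rw [Representation.irreducible_iff_isSimpleModule_asModule] at hτ ⊢
  exact IsSimpleModule.congr (LinearEquiv.ofBijective
    (Representation.IntertwiningMap.equivLinearMapAsModule β τ e.toIntertwiningMap)
    e.toLinearEquiv.bijective)

end Lattice

section Factors

variable {k G V W A : Type*} [Field k] [Group G] [AddCommGroup V] [Module k V]
  [AddCommGroup W] [Module k W] [AddCommGroup A] [Module k A]
  {ρ : Representation k G V} {τ : Representation k G W} {β : Representation k G A}

/-- `β` is a quotient of a subrepresentation of `ρ`. -/
def IsSubquotient (β : Representation k G A) (ρ : Representation k G V) : Prop :=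
  ∃ (X : Subrepresentation ρ) (φ : X.toRepresentation.IntertwiningMap β), Function.Surjective φ

theorem IsSubquotient.of_surjective (h : IsSubquotient β τ) (f : ρ.IntertwiningMap τ)
    (hf : Function.Surjective f) : IsSubquotient β ρ := by
  obtain ⟨X, φ, hφ⟩ := h
  let r : (comapSub f X).toRepresentation.IntertwiningMap X.toRepresentation :=
    { toLinearMap := f.toLinearMap.restrict fun _ hv => hv
      isIntertwining' := fun g => LinearMap.ext fun v => Subtype.ext (f.isIntertwining _ _ g v) }
  refine ⟨comapSub f X, φ.comp r, hφ.comp fun x => ?_⟩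
  obtain ⟨v, hv⟩ := hf x
  exact ⟨⟨v, show f v ∈ X from hv ▸ x.2⟩, Subtype.ext hv⟩

theorem IsSubquotient.of_injective (h : IsSubquotient β ρ) (f : ρ.IntertwiningMap τ)
    (hf : Function.Injective f) : IsSubquotient β τ := by
  obtain ⟨X, φ, hφ⟩ := h
  let e := Submodule.equivMapOfInjective f.toLinearMap hf X.toSubmodule
  let r : X.toRepresentation.Equiv (mapSub f X).toRepresentation := .mk e fun g =>
    LinearMap.ext fun v => Subtype.ext (f.isIntertwining _ _ g v)
  exact ⟨mapSub f X, φ.comp r.symm.toIntertwiningMap, hφ.comp r.symm.toLinearEquiv.surjective⟩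

theorem isSubquotient_of_surjective (f : ρ.IntertwiningMap β) (hf : Function.Surjective f) :
    IsSubquotient β ρ :=
  IsSubquotient.of_surjective ⟨⊤, subtypeMap ⊤, fun v => ⟨⟨v, trivial⟩, rfl⟩⟩ f hf

theorem IsSubquotient.of_equiv {α : Representation k G W} (h : IsSubquotient β ρ)
    (e : β.Equiv α) : IsSubquotient α ρ := by
  obtain ⟨X, φ, hφ⟩ := h
  exact ⟨X, e.toIntertwiningMap.comp φ, e.toLinearEquiv.surjective.comp hφ⟩

theorem isSubquotient_subquotient {Y X T : Subrepresentation ρ} (h : X ≤ T) :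
    IsSubquotient (subquotient Y X) T.toRepresentation :=
  (isSubquotient_of_surjective (mkMap Y X) (mkMap_surjective Y X)).of_injective (inclusionMap h)
    (Submodule.inclusion_injective (p := X.toSubmodule) h)

/-- A maximal chain of subrepresentations, read from top to bottom, as a composition series. -/
def CompSeries.ofRelSeries (t : RelSeries {(Y, X) : Subrepresentation ρ × Subrepresentation ρ |
    Y ⋖ X}) (hbot : t.head = ⊥) (htop : t.last = ⊤) : CompSeries ρ :=
  have hcov : ∀ i : Fin t.length, t i.succ.rev ⋖ t i.castSucc.rev := fun i => by
    rw [Fin.rev_succ, Fin.rev_castSucc]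
    exact t.step i.rev
  { length := t.length
    sub := fun i => t i.rev
    sub_zero := by rw [Fin.rev_zero]; exact htop
    sub_last := by rw [Fin.rev_last]; exact hbot
    le := fun i => (hcov i).le
    irreducible := fun i => (isIrreducible_subquotient_iff (hcov i).le).2 (hcov i) }

theorem isJHFactor_of_covBy [FiniteDimensional k V] {Y X : Subrepresentation ρ} (h : Y ⋖ X)
    (e : β.Equiv (subquotient Y X)) : IsJHFactor β ρ := by
  obtain ⟨t, ι, hι, hbot, htop⟩ :=
    LTSeries.exists_relSeries_covBy_and_head_eq_bot_and_last_eq_bot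
      (LTSeries.mk 1 ![Y, X] (by simpa [Fin.strictMono_iff_lt_succ] using h.lt))
  have hY : t (ι 0) = Y := congrFun hι 0
  have hX : t (ι 1) = X := congrFun hι 1
  have hmono : StrictMono t := Fin.strictMono_iff_lt_succ.2 fun i => (t.step i).lt
  have hlt : ι 0 < ι 1 := hmono.lt_iff_lt.1 (by rw [hY, hX]; exact h.lt)
  obtain ⟨i, hi⟩ := Fin.exists_castSucc_eq.2 (Fin.ne_last_of_lt hlt)
  rw [← hi] at hY hlt
  have hcov : Y ⋖ t i.succ := hY ▸ t.step i
  have hle : t i.succ ≤ X := hX ▸ hmono.monotone (Fin.castSucc_lt_iff_succ_le.1 hlt)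
  have hiX : t i.succ = X := (h.eq_or_eq hcov.le hle).resolve_left hcov.lt.ne'
  refine ⟨.ofRelSeries t hbot htop, i.rev, ?_⟩
  suffices ∀ Y' X', Y' = Y → X' = X → Nonempty (β.Equiv (subquotient Y' X')) from
    this _ _ (by simp [CompSeries.ofRelSeries, Fin.rev_succ, hY])
      (by simp [CompSeries.ofRelSeries, Fin.rev_castSucc, hiX])
  rintro _ _ rfl rfl
  exact ⟨e⟩

theorem IsSubquotient.isJHFactor [FiniteDimensional k V] [β.IsIrreducible]
    (h : IsSubquotient β ρ) : IsJHFactor β ρ := by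
  obtain ⟨X, φ, hφ⟩ := h
  let Y := mapSub (subtypeMap X) φ.ker
  have hYX : Y ≤ X := Submodule.map_subtype_le _ _
  have hker : Y.toSubmodule.submoduleOf X.toSubmodule = LinearMap.ker φ.toLinearMap :=
    Submodule.comap_map_eq_of_injective X.toSubmodule.injective_subtype _
  let e : (subquotient Y X).Equiv β := .mk ((Submodule.quotEquivOfEq _ _ hker).trans
      (φ.toLinearMap.quotKerEquivOfSurjective hφ)) fun g => by
    refine LinearMap.ext fun z => ?_
    obtain ⟨v, rfl⟩ := Submodule.Quotient.mk_surjective _ z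
    exact φ.isIntertwining _ _ g v
  exact isJHFactor_of_covBy ((isIrreducible_subquotient_iff hYX).1 (isIrreducible_of_equiv e))
    e.symm

end Factors

section Twist

variable {k G A B W : Type*} [Field k] [Group G] [AddCommGroup A] [Module k A]
  [AddCommGroup B] [Module k B] [AddCommGroup W] [Module k W]

/-- The twist `α ⊗ χ` of a representation by a character, on the same vector space as `α`. -/
def twist (χ : G →* k) (α : Representation k G A) : Representation k G A where
  toFun g := χ g • α g
  map_one' := by simp
  map_mul' g h := by rw [map_mul, map_mul, smul_mul_smul_comm]

variable {χ : G →* k} {α : Representation k G A} {β : Representation k G B}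
  {ρ : Representation k G W}

/-- Subrepresentations of a twist are subrepresentations. -/
def twistOrderIso (χ : G →* k) (α : Representation k G A) :
    Subrepresentation (twist χ α) ≃o Subrepresentation α where
  toFun X := ⟨X.toSubmodule, fun g _ hv =>
    (X.toSubmodule.smul_mem_iff ((Group.isUnit g).map χ).ne_zero).1 (X.apply_mem_toSubmodule g hv)⟩
  invFun X := ⟨X.toSubmodule, fun g _ hv =>
    X.toSubmodule.smul_mem _ (X.apply_mem_toSubmodule g hv)⟩
  left_inv _ := rfl
  right_inv _ := rfl
  map_rel_iff' := Iff.rfl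

instance [α.IsIrreducible] : (twist χ α).IsIrreducible :=
  (twistOrderIso χ α).isSimpleOrder_iff.2 ‹_›

/-- Tensoring with a line on which the group acts through `χ` is twisting by `χ`. -/
def tprodEquivTwist (α : Representation k G A) {γ : Representation k G k}
    (hγ : ∀ g x, γ g x = χ g * x) : (α.tprod γ).Equiv (twist χ α) :=
  .mk (TensorProduct.rid k A) fun g => TensorProduct.ext' fun a x => by
    simp [twist, hγ, smul_smul, mul_comm]

/-- A vector of `Hom(A, B)` on which the group acts through `χ` is an intertwining map from the
twist of `A` to `B`. -/
def intertwiningMapOfLinHom (v : A →ₗ[k] B) (hv : ∀ g, α.linHom β g v = χ g • v) :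
    (twist χ α).IntertwiningMap β where
  toLinearMap := v
  isIntertwining' g := LinearMap.ext fun a => by
    simpa [twist] using (LinearMap.congr_fun (hv g) (α g a)).symm

theorem isSubquotient_twist_of_linHom [α.IsIrreducible] {Y X T : Subrepresentation ρ}
    (hYX : Y ⋖ X) (hXT : X ≤ T)
    {v : A →ₗ[k] X.toSubmodule ⧸ Y.toSubmodule.submoduleOf X.toSubmodule}
    (hv : ∀ g, α.linHom (subquotient Y X) g v = χ g • v) (hv0 : v ≠ 0) :
    IsSubquotient (twist χ α) T.toRepresentation := by
  have := (isIrreducible_subquotient_iff hYX.le).2 hYX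
  have hbij := (Representation.IsIrreducible.bijective_or_eq_zero
    (intertwiningMapOfLinHom v hv)).resolve_right
      fun h => hv0 (congrArg Representation.IntertwiningMap.toLinearMap h)
  exact (isSubquotient_subquotient hXT).of_equiv
    (Representation.IntertwiningMap.ofBijective _ hbij).symm

end Twist

section Cocycles

variable {k G M : Type*} [Field k] [Group G] [AddCommGroup M] [Module k M]
  {ρ : Representation k G M} {c : G → M}

/-- `c` is an inhomogeneous 1-cocycle of `G` with values in the representation `ρ`. -/
def IsOneCocycle (ρ : Representation k G M) (c : G → M) : Prop :=
  ∀ g h, c (g * h) = c g + ρ g (c h)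

theorem isOneCocycle_sub (ρ : Representation k G M) (v : M) :
    IsOneCocycle ρ fun g => ρ g v - v := fun g h => by
  beta_reduce
  rw [map_mul, Module.End.mul_apply, map_sub]
  abel

namespace IsOneCocycle

theorem map_one (hc : IsOneCocycle ρ c) : c 1 = 0 := by
  simpa using hc 1 1

theorem map_mul_of_eq_zero (hc : IsOneCocycle ρ c) {g h : G} (hh : c h = 0) :
    c (g * h) = c g := by
  rw [hc, hh, map_zero, add_zero]

theorem map_pow (hc : IsOneCocycle ρ c) {x : G} (hx : ρ x = 1) (j : ℕ) :
    c (x ^ j) = (j : k) • c x := by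
  induction j with
  | zero => simpa using hc.map_one
  | succ j ih => simp [pow_succ', hc x, hx, ih, add_smul, add_comm]

theorem map_conj (hc : IsOneCocycle ρ c) {x : G} (hx : ρ x = 1) (g : G) :
    c (g * x * g⁻¹) = ρ g (c x) := by
  have h0 : c g + ρ g (c g⁻¹) = 0 := by rw [← hc, mul_inv_cancel, hc.map_one]
  rw [mul_assoc, hc, hc, hx, Module.End.one_apply, map_add, add_left_comm, h0, add_zero]

end IsOneCocycle

end Cocycles

section KummerChain

variable {k G M : Type*} [Field k] [Group G] [AddCommGroup M] [Module k M]
  {ρ : Representation k G M} {c : G → M} {χ : G →* k} {P H H' : Subgroup G}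

/-- `H` is generated by `H'` and an element of `P` on which conjugation by `H` acts, modulo `H'`,
through the character `χ`: the group theory of a Kummer extension of degree `p`. -/
def IsKummerStep (χ : G →* k) (P H H' : Subgroup G) : Prop :=
  ∃ x ∈ P ⊓ H, (∀ g ∈ H, ∃ j : ℕ, (x ^ j)⁻¹ * g ∈ H') ∧
    ∀ g ∈ H, ∃ j : ℕ, (j : k) = χ g ∧ (x ^ j)⁻¹ * (g * x * g⁻¹) ∈ H'

theorem IsKummerStep.cocycle_eq_zero (hH : IsKummerStep χ P H H') (hχP : ∀ x ∈ P, χ x = 1)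
    (hPH : ∀ g, ∃ x ∈ P, x⁻¹ * g ∈ H) (hc : IsOneCocycle ρ c) (hP : ∀ x ∈ P, ρ x = 1)
    (hχ : ∀ v, (∀ g, ρ g v = χ g • v) → v = 0) (hc' : ∀ g ∈ H', c g = 0) :
    ∀ g ∈ H, c g = 0 := by
  obtain ⟨x, ⟨hxP, -⟩, hgen, hconj⟩ := hH
  have hc_eq : ∀ (j : ℕ) (g : G), (x ^ j)⁻¹ * g ∈ H' → c g = (j : k) • c x := fun j g hg => by
    rw [← hc.map_pow (hP x hxP), ← hc.map_mul_of_eq_zero (g := x ^ j) (hc' _ hg),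
      mul_inv_cancel_left]
  have hx_eigen : ∀ g, ρ g (c x) = χ g • c x := fun g => by
    obtain ⟨z, hz, hzg⟩ := hPH g
    obtain ⟨j, hj, hxj⟩ := hconj _ hzg
    have h := hc_eq j _ hxj
    rwa [hc.map_conj (hP x hxP), hj, map_mul, map_mul, hP _ (P.inv_mem hz),
      hχP _ (P.inv_mem hz), one_mul, one_mul] at h
  intro g hg
  obtain ⟨j, hj⟩ := hgen g hg
  rw [hc_eq j g hj, hχ _ hx_eigen, smul_zero]

/-- A chain of subgroups `H 0 ≥ H 1 ≥ ⋯ ≥ H m` starting at the whole group, in which every step is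
generated by an element of `P` on which conjugation acts through the character `χ`. -/
structure IsKummerChain (χ : G →* k) (P : Subgroup G) (H : ℕ → Subgroup G) (m : ℕ) : Prop where
  zero : H 0 = ⊤
  char_eq_one : ∀ x ∈ P, χ x = 1
  step : ∀ n < m, IsKummerStep χ P (H n) (H (n + 1))

variable {H : ℕ → Subgroup G} {m : ℕ}

theorem IsKummerChain.exists_inv_mul_mem (hH : IsKummerChain χ P H m) {n : ℕ} (hn : n ≤ m)
    (g : G) : ∃ x ∈ P, x⁻¹ * g ∈ H n := by
  induction n with
  | zero => exact ⟨1, P.one_mem, by simp [hH.zero]⟩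
  | succ n ih =>
    obtain ⟨x, hx, hxg⟩ := ih (by lia)
    obtain ⟨y, hy, hgen, -⟩ := hH.step n (by lia)
    obtain ⟨j, hj⟩ := hgen _ hxg
    refine ⟨x * y ^ j, P.mul_mem hx (P.pow_mem hy.1 j), ?_⟩
    rwa [mul_inv_rev, mul_assoc]

theorem IsKummerChain.cocycle_eq_zero (hH : IsKummerChain χ P H m) (hc : IsOneCocycle ρ c)
    (hP : ∀ x ∈ P, ρ x = 1) (hχ : ∀ v, (∀ g, ρ g v = χ g • v) → v = 0)
    (hm : ∀ g ∈ H m, c g = 0) (g : G) : c g = 0 := by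
  refine Nat.decreasingInduction (motive := fun n _ => ∀ g ∈ H n, c g = 0)
    (fun n hn ih => ?_) hm (Nat.zero_le m) g (hH.zero ▸ Subgroup.mem_top g)
  exact (hH.step n hn).cocycle_eq_zero hH.char_eq_one (hH.exists_inv_mul_mem hn.le) hc hP hχ ih

end KummerChain

section Descent

variable {k G A W : Type*} [Field k] [Group G] [AddCommGroup A] [Module k A]
  [AddCommGroup W] [Module k W]

/-- `P` acts trivially on all irreducible subquotients of `ρ`. -/
def TrivialOnFactors (P : Subgroup G) (ρ : Representation k G W) : Prop :=
  ∀ Y X : Subrepresentation ρ, Y ⋖ X → ∀ x ∈ P, ∀ v ∈ X, ρ x v - v ∈ Y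

variable {χ : G →* k} {P : Subgroup G} {H : ℕ → Subgroup G} {m : ℕ}
  {α : Representation k G A} {ρ : Representation k G W}

theorem TrivialOnFactors.subquotient_eq_one (hP : TrivialOnFactors P ρ)
    {Y X : Subrepresentation ρ} (h : Y ⋖ X) {x : G} (hx : x ∈ P) : subquotient Y X x = 1 := by
  ext v
  exact mkMap_eq_iff.2 (hP Y X h x hx v v.2)

theorem IsKummerChain.cocycle_mem_of_covBy [α.IsIrreducible] (hH : IsKummerChain χ P H m)
    (hPα : ∀ x ∈ P, α x = 1) (hPρ : TrivialOnFactors P ρ) {Y X : Subrepresentation ρ}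
    (hYX : Y ⋖ X) (hX : ¬ IsSubquotient (twist χ α) X.toRepresentation) {c : G → A →ₗ[k] W}
    (hc : IsOneCocycle (α.linHom ρ) c) (hcX : ∀ g a, c g a ∈ X)
    (hcY : ∀ g ∈ H m, ∀ a, c g a ∈ Y) (g : G) (a : A) : c g a ∈ Y := by
  let cX : G → A →ₗ[k] X.toSubmodule := fun g => (c g).codRestrict X.toSubmodule (hcX g)
  let cXY : G → A →ₗ[k] X.toSubmodule ⧸ Y.toSubmodule.submoduleOf X.toSubmodule :=
    fun g => (mkMap Y X).toLinearMap ∘ₗ cX g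
  have hcXY : IsOneCocycle (α.linHom (subquotient Y X)) cXY := fun g h => LinearMap.ext fun a =>
    congrArg (mkMap Y X) (a₁ := cX (g * h) a)
      (a₂ := cX g a + X.toRepresentation g (cX h (α g⁻¹ a)))
      (Subtype.ext (LinearMap.congr_fun (hc g h) a))
  have hzero : cXY g = 0 := by
    refine hH.cocycle_eq_zero hcXY (fun x hx => ?_) (fun v hv => ?_) (fun h hh => ?_) g
    · ext v b
      simp [hPα _ (P.inv_mem hx), hPρ.subquotient_eq_one hYX hx]
    · by_contra hv0
      exact hX (isSubquotient_twist_of_linHom hYX le_rfl hv hv0)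
    · exact LinearMap.ext fun b => mkMap_eq_zero_iff.2 (hcY h hh b)
  exact mkMap_eq_zero_iff.1 (LinearMap.congr_fun hzero a)

theorem IsKummerChain.cocycle_mem [FiniteDimensional k W] [α.IsIrreducible]
    (hH : IsKummerChain χ P H m) (hPα : ∀ x ∈ P, α x = 1) (hPρ : TrivialOnFactors P ρ)
    {U T : Subrepresentation ρ} (hUT : U ≤ T)
    (hT : ¬ IsSubquotient (twist χ α) T.toRepresentation) {c : G → A →ₗ[k] W}
    (hc : IsOneCocycle (α.linHom ρ) c) (hcT : ∀ g a, c g a ∈ T)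
    (hcU : ∀ g ∈ H m, ∀ a, c g a ∈ U) : ∀ g a, c g a ∈ U := by
  induction T using WellFoundedLT.induction with
  | ind T ih =>
  rcases hUT.eq_or_lt with rfl | hlt
  · exact hcT
  obtain ⟨Y, hUY, hYT⟩ := exists_le_covBy_of_lt hlt
  have hY : ¬ IsSubquotient (twist χ α) Y.toRepresentation := fun h =>
    hT (h.of_injective (inclusionMap hYT.le)
      (Submodule.inclusion_injective (p := Y.toSubmodule) hYT.le))
  exact ih Y hYT.lt hUY hY
    (hH.cocycle_mem_of_covBy hPα hPρ hYT hT hc hcT fun g hg a => hUY (hcU g hg a))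

end Descent

section Stability

variable {k G W : Type*} [Field k] [Group G] [AddCommGroup W] [Module k W]
  {ρ : Representation k G W}

/-- The restriction of a representation to a subgroup. -/
abbrev restrict (ρ : Representation k G W) (S : Subgroup G) : Representation k S W :=
  ρ.comp S.subtype

theorem mem_invtSubmodule_iff {U : Submodule k W} :
    U ∈ ρ.invtSubmodule ↔ ∃ X : Subrepresentation ρ, X.toSubmodule = U := by
  rw [ρ.mem_invtSubmodule]
  exact ⟨fun h => ⟨⟨U, fun g _ hu => h g hu⟩, rfl⟩,
    fun ⟨X, hX⟩ g _ hu => hX ▸ X.apply_mem_toSubmodule g (hX ▸ hu)⟩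

theorem toSubmodule_mem_invtSubmodule_restrict (X : Subrepresentation ρ) (S : Subgroup G) :
    X.toSubmodule ∈ (restrict ρ S).invtSubmodule :=
  mem_invtSubmodule_iff.2 ⟨⟨X.toSubmodule, fun g _ hv => X.apply_mem_toSubmodule g hv⟩, rfl⟩

theorem exists_section_mem {U X Y : Submodule k W} (hUX : U ≤ X) (hX : X ≤ U ⊔ Y) :
    ∃ σ : X ⧸ Y.submoduleOf X →ₗ[k] W,
      (∀ z, σ z ∈ U) ∧ ∀ v : X, σ (Submodule.Quotient.mk v) - v ∈ Y := by
  let q : U →ₗ[k] X ⧸ Y.submoduleOf X := Submodule.mkQ _ ∘ₗ Submodule.inclusion hUX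
  have hq : Function.Surjective q := fun z => by
    obtain ⟨w, rfl⟩ := Submodule.Quotient.mk_surjective _ z
    obtain ⟨u, hu, y, hy, huy⟩ := Submodule.mem_sup.1 (hX w.2)
    refine ⟨⟨u, hu⟩, (Submodule.Quotient.eq _).2 ?_⟩
    change u - (w : W) ∈ Y
    simpa [← huy] using hy
  obtain ⟨t, ht⟩ := q.exists_rightInverse_of_surjective (LinearMap.range_eq_top.2 hq)
  exact ⟨U.subtype ∘ₗ t, fun z => (t z).2,
    fun v => (Submodule.Quotient.eq (Y.submoduleOf X)).1
      (LinearMap.congr_fun ht (Submodule.Quotient.mk v))⟩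

variable {χ : G →* k} {P : Subgroup G} {H : ℕ → Subgroup G} {m : ℕ} {Y X : Subrepresentation ρ}
  {U : Submodule k W}

theorem IsKummerChain.mem_invtSubmodule_of_covBy (hH : IsKummerChain χ P H m)
    (hP : TrivialOnFactors P ρ) (hYX : Y ⋖ X) (hYU : Y.toSubmodule ≤ U) (hUX : U ≤ X.toSubmodule)
    (hU : U ∈ (restrict ρ (H m)).invtSubmodule) : U ∈ ρ.invtSubmodule := by
  rw [Representation.mem_invtSubmodule] at hU ⊢
  intro g u hu
  obtain ⟨x, hx, hxg⟩ := hH.exists_inv_mul_mem le_rfl g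
  have hw : ρ (x⁻¹ * g) u ∈ U := hU ⟨_, hxg⟩ hu
  have h := U.add_mem (hYU (hP Y X hYX x hx _ (hUX hw))) hw
  rwa [sub_add_cancel, ← Module.End.mul_apply, ← map_mul, mul_inv_cancel_left] at h

theorem linHom_sub_apply_mem_of_section
    {σ : X.toSubmodule ⧸ Y.toSubmodule.submoduleOf X.toSubmodule →ₗ[k] W}
    (hσ : ∀ v : X.toSubmodule, σ (mkMap Y X v) - v ∈ Y) (g : G)
    (a : X.toSubmodule ⧸ Y.toSubmodule.submoduleOf X.toSubmodule) :
    ((subquotient Y X).linHom ρ g σ - σ) a ∈ Y := by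
  obtain ⟨v, rfl⟩ := mkMap_surjective Y X a
  have h := Y.toSubmodule.sub_mem
    (Y.apply_mem_toSubmodule g (hσ (X.toRepresentation g⁻¹ v))) (hσ v)
  have hv : ρ g (X.toRepresentation g⁻¹ v : X.toSubmodule) = v := ρ.self_inv_apply g v
  rw [map_sub, hv, sub_sub_sub_cancel_right] at h
  exact h

theorem mem_invtSubmodule_of_section (hUX : U ≤ X.toSubmodule)
    (hUY : U ⊓ Y.toSubmodule ∈ ρ.invtSubmodule)
    {σ : X.toSubmodule ⧸ Y.toSubmodule.submoduleOf X.toSubmodule →ₗ[k] W} (hσU : ∀ z, σ z ∈ U)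
    (hσY : ∀ v : X.toSubmodule, σ (mkMap Y X v) - v ∈ Y)
    (hσ : ∀ g a, ((subquotient Y X).linHom ρ g σ - σ) a ∈ U) : U ∈ ρ.invtSubmodule := by
  refine ρ.mem_invtSubmodule.2 fun g u hu => ?_
  let z := mkMap Y X ⟨u, hUX hu⟩
  have hσz : ρ g (σ z) ∈ U := by
    have h := U.add_mem (hσ g (subquotient Y X g z)) (hσU (subquotient Y X g z))
    simpa using h
  have hdiff : ρ g (σ z - u) ∈ U :=
    (ρ.mem_invtSubmodule.1 hUY g ⟨U.sub_mem (hσU z) hu, hσY ⟨u, hUX hu⟩⟩).1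
  simpa using U.sub_mem hσz hdiff

theorem IsKummerChain.mem_invtSubmodule_of_inf_mem [FiniteDimensional k W]
    (hH : IsKummerChain χ P H m) (hP : TrivialOnFactors P ρ) (hYX : Y ⋖ X)
    (hY : ¬ IsSubquotient (twist χ (subquotient Y X)) Y.toRepresentation)
    (hUX : U ≤ X.toSubmodule) (hU : U ∈ (restrict ρ (H m)).invtSubmodule)
    (hUY : U ⊓ Y.toSubmodule ∈ ρ.invtSubmodule) : U ∈ ρ.invtSubmodule := by
  obtain ⟨Z, hZ⟩ := mem_invtSubmodule_iff.1 <| hH.mem_invtSubmodule_of_covBy hP hYX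
    le_sup_right (sup_le hUX hYX.le)
    (Sublattice.sup_mem hU (toSubmodule_mem_invtSubmodule_restrict Y _))
  have hYZ : Y ≤ Z := le_sup_right (a := U).trans_eq hZ.symm
  have hZX : Z ≤ X := hZ.trans_le (sup_le hUX hYX.le)
  rcases hYX.eq_or_eq hYZ hZX with rfl | rfl
  · rwa [inf_eq_left.2 (sup_eq_right.1 hZ.symm)] at hUY
  obtain ⟨σ, hσU, hσY⟩ := exists_section_mem hUX hZ.le
  obtain ⟨N, hN⟩ := mem_invtSubmodule_iff.1 hUY
  have hσN : ∀ g a, ((subquotient Y Z).linHom ρ g σ - σ) a ∈ N := by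
    have := (isIrreducible_subquotient_iff hYX.le).2 hYX
    have hcoboundary := linHom_sub_apply_mem_of_section hσY
    refine hH.cocycle_mem (fun x hx => hP.subquotient_eq_one hYX hx) hP (hN.trans_le inf_le_right)
      hY (isOneCocycle_sub _ σ) hcoboundary fun g hg a => hN.ge ⟨?_, hcoboundary g a⟩
    exact U.sub_mem ((Representation.mem_invtSubmodule _).1 hU ⟨g, hg⟩ (hσU _)) (hσU a)
  exact mem_invtSubmodule_of_section hUX hUY hσU hσY fun g a => hN.trans_le inf_le_left (hσN g a)

/-- The twist of each factor `V_i / V_{i+1}` by `χ` does not occur in `V_{i+1}`; unlike in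
`IsCyclotomicFree`, occurrence is as a subquotient. -/
def CompSeries.IsTwistFree (χ : G →* k) (s : CompSeries ρ) : Prop :=
  ∀ i, ¬ IsSubquotient (twist χ (s.factor i)) (s.sub i.succ).toRepresentation

theorem IsKummerChain.invtSubmodule_restrict_le [FiniteDimensional k W]
    (hH : IsKummerChain χ P H m) (hP : TrivialOnFactors P ρ) {s : CompSeries ρ}
    (hs : s.IsTwistFree χ) : (restrict ρ (H m)).invtSubmodule ≤ ρ.invtSubmodule := by
  suffices ∀ i, ∀ U ∈ (restrict ρ (H m)).invtSubmodule, U ≤ (s.sub i).toSubmodule →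
      U ∈ ρ.invtSubmodule from
    fun U hU => this 0 U hU (by rw [s.sub_zero]; exact le_top)
  intro i
  induction i using Fin.reverseInduction with
  | last =>
    intro U _ hUs
    rw [s.sub_last] at hUs
    rw [le_bot_iff.1 hUs]
    exact Representation.invtSubmodule.bot_mem ρ
  | cast i ih =>
    intro U hU hUs
    exact hH.mem_invtSubmodule_of_inf_mem hP (s.covBy i) (hs i) hUs hU <|
      ih _ (Sublattice.inf_mem hU (toSubmodule_mem_invtSubmodule_restrict _ _)) inf_le_right

end Stability

section Equivariance

variable {k G V W : Type*} [Field k] [Group G] [AddCommGroup V] [Module k V]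
  [AddCommGroup W] [Module k W] {ρ : Representation k G V} {τ : Representation k G W}
  {f : V →ₗ[k] W}

theorem map_mem_invtSubmodule (hf : Representation.IsIntertwiningMap ρ τ f) {U : Submodule k V}
    (hU : U ∈ ρ.invtSubmodule) : U.map f ∈ τ.invtSubmodule := by
  refine τ.mem_invtSubmodule.2 fun g => ?_
  rintro _ ⟨u, hu, rfl⟩
  exact ⟨ρ g u, ρ.mem_invtSubmodule.1 hU g hu, hf.isIntertwining g u⟩

theorem comap_mem_invtSubmodule (hf : Representation.IsIntertwiningMap ρ τ f)
    {Z : Submodule k W} (hZ : Z ∈ τ.invtSubmodule) : Z.comap f ∈ ρ.invtSubmodule :=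
  ρ.mem_invtSubmodule.2 fun g v hv => by
    simpa [hf.isIntertwining] using τ.mem_invtSubmodule.1 hZ g hv

variable {χ : G →* k} {P : Subgroup G} {H : ℕ → Subgroup G} {m : ℕ} {Y X : Subrepresentation ρ}
  {fY fX : Subrepresentation τ}

theorem IsKummerChain.covBy_of_map_eq (hH : IsKummerChain χ P H m) (hP : TrivialOnFactors P ρ)
    (hf : Representation.IsIntertwiningMap (restrict ρ (H m)) (restrict τ (H m)) f) (hYX : Y ⋖ X)
    (hfX : fX.toSubmodule = X.toSubmodule.map f) (hfY : fY.toSubmodule = Y.toSubmodule.map f)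
    (hlt : fY < fX) : fY ⋖ fX := by
  refine ⟨hlt, fun Z hYZ hZX => ?_⟩
  have hYZ' : Y.toSubmodule ≤ Z.toSubmodule.comap f :=
    Submodule.map_le_iff_le_comap.1 (hfY.symm.trans_le hYZ.le)
  obtain ⟨Z', hZ'⟩ := mem_invtSubmodule_iff.1 <| hH.mem_invtSubmodule_of_covBy hP hYX
    (U := X.toSubmodule ⊓ Z.toSubmodule.comap f) (le_inf hYX.le hYZ') inf_le_left
    (Sublattice.inf_mem (toSubmodule_mem_invtSubmodule_restrict X _)
      (comap_mem_invtSubmodule hf (toSubmodule_mem_invtSubmodule_restrict Z _)))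
  have hmap : Z'.toSubmodule.map f = Z.toSubmodule := by
    rw [hZ', ← Submodule.map_inf_eq_map_inf_comap, ← hfX]
    exact inf_eq_right.2 hZX.le
  have hle : Y ≤ Z' := fun y hy => hZ'.ge ⟨hYX.le hy, hYZ' hy⟩
  rcases hYX.eq_or_eq hle (hZ'.trans_le inf_le_left) with rfl | rfl
  · exact hYZ.ne (Subrepresentation.toSubmodule_injective (hfY.trans hmap))
  · exact hZX.ne' (Subrepresentation.toSubmodule_injective (hfX.trans hmap))

theorem IsKummerChain.sub_mem_of_map_eq (hH : IsKummerChain χ P H m)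
    (hPρ : TrivialOnFactors P ρ) (hPτ : TrivialOnFactors P τ)
    (hf : Representation.IsIntertwiningMap (restrict ρ (H m)) (restrict τ (H m)) f) (hYX : Y ⋖ X)
    (hfX : fX.toSubmodule = X.toSubmodule.map f) (hfY : fY.toSubmodule = Y.toSubmodule.map f)
    (g : G) {v : V} (hv : v ∈ X) : τ g (f (ρ g⁻¹ v)) - f v ∈ fY := by
  have hfXmem : ∀ {v}, v ∈ X → f v ∈ fX := fun hv => hfX.ge ⟨_, hv, rfl⟩
  have hle : fY ≤ fX := by
    change fY.toSubmodule ≤ fX.toSubmodule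
    rw [hfX, hfY]
    exact Submodule.map_mono hYX.le
  obtain ⟨x, hx, hxg⟩ := hH.exists_inv_mul_mem le_rfl g
  have htriv : τ x (f v) - f v ∈ fY := by
    rcases hle.eq_or_lt with rfl | hlt
    · exact fY.toSubmodule.sub_mem (fY.apply_mem_toSubmodule x (hfXmem hv)) (hfXmem hv)
    · exact hPτ fY fX (hH.covBy_of_map_eq hPρ hf hYX hfX hfY hlt) x hx _ (hfXmem hv)
  have hgx : τ g (f (ρ g⁻¹ v)) = τ x (f (ρ x⁻¹ v)) := by
    have h : f (ρ (x⁻¹ * g) (ρ g⁻¹ v)) = τ (x⁻¹ * g) (f (ρ g⁻¹ v)) := hf.isIntertwining ⟨_, hxg⟩ _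
    rw [← Module.End.mul_apply, ← map_mul, mul_inv_cancel_right] at h
    rw [h, ← Module.End.mul_apply, ← map_mul, mul_inv_cancel_left]
  have hsub : f (ρ x⁻¹ v) - f v ∈ fY :=
    hfY.ge ⟨_, hPρ Y X hYX _ (P.inv_mem hx) v hv, map_sub _ _ _⟩
  have h := fY.toSubmodule.add_mem (fY.apply_mem_toSubmodule x hsub) htriv
  rwa [map_sub, sub_add_sub_cancel, ← hgx] at h

theorem exists_isOneCocycle_of_apply_eq (X : Subrepresentation ρ)
    (hY : ∀ g, ∀ v ∈ Y, f (ρ g v) = τ g (f v)) :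
    ∃ c, IsOneCocycle ((subquotient Y X).linHom τ) c ∧
      ∀ g (v : X.toSubmodule), c g (mkMap Y X v) = τ g (f (ρ g⁻¹ v)) - f v := by
  have hker (g) : Y.toSubmodule.submoduleOf X.toSubmodule ≤
      LinearMap.ker ((ρ.linHom τ g f - f) ∘ₗ X.toSubmodule.subtype) := fun y hy => by
    have h := hY g (ρ g⁻¹ y) (Y.apply_mem_toSubmodule _ hy)
    rw [ρ.self_inv_apply] at h
    simp [← h]
  refine ⟨fun g => Submodule.liftQ _ _ (hker g), fun g h => LinearMap.ext fun a => ?_,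
    fun _ _ => rfl⟩
  obtain ⟨v, rfl⟩ := mkMap_surjective Y X a
  exact LinearMap.congr_fun (isOneCocycle_sub (ρ.linHom τ) f g h) v

theorem isSubquotient_of_map_eq {A : Type*} [AddCommGroup A] [Module k A]
    {β : Representation k G A} (hY : ∀ g, ∀ v ∈ Y, f (ρ g v) = τ g (f v))
    (hfY : fY.toSubmodule = Y.toSubmodule.map f) (h : IsSubquotient β fY.toRepresentation) :
    IsSubquotient β Y.toRepresentation := by
  let f' : Y.toRepresentation.IntertwiningMap fY.toRepresentation :=
    { toLinearMap := f.restrict fun y hy => hfY.ge ⟨y, hy, rfl⟩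
      isIntertwining' := fun g => LinearMap.ext fun y => Subtype.ext (hY g y y.2) }
  refine h.of_surjective f' fun ⟨w, hw⟩ => ?_
  obtain ⟨y, hy, rfl⟩ := hfY.le hw
  exact ⟨⟨y, hy⟩, rfl⟩

theorem IsKummerChain.apply_eq_of_covBy [FiniteDimensional k W] (hH : IsKummerChain χ P H m)
    (hPρ : TrivialOnFactors P ρ) (hPτ : TrivialOnFactors P τ)
    (hτ : (restrict τ (H m)).invtSubmodule ≤ τ.invtSubmodule)
    (hf : Representation.IsIntertwiningMap (restrict ρ (H m)) (restrict τ (H m)) f) (hYX : Y ⋖ X)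
    (hY : ¬ IsSubquotient (twist χ (subquotient Y X)) Y.toRepresentation)
    (hfY : ∀ g, ∀ v ∈ Y, f (ρ g v) = τ g (f v)) (g : G) {v : V} (hv : v ∈ X) :
    f (ρ g v) = τ g (f v) := by
  have himage (Z : Subrepresentation ρ) : ∃ fZ : Subrepresentation τ,
      fZ.toSubmodule = Z.toSubmodule.map f := mem_invtSubmodule_iff.1 <|
    hτ (map_mem_invtSubmodule hf (toSubmodule_mem_invtSubmodule_restrict Z _))
  obtain ⟨⟨fX, hfX_eq⟩, ⟨fY, hfY_eq⟩⟩ := And.intro (himage X) (himage Y)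
  obtain ⟨c, hc, hc_mk⟩ := exists_isOneCocycle_of_apply_eq X hfY
  have := (isIrreducible_subquotient_iff hYX.le).2 hYX
  have hc0 : ∀ g a, c g a ∈ (⊥ : Subrepresentation τ) := by
    refine hH.cocycle_mem (fun x hx => hPρ.subquotient_eq_one hYX hx) hPτ bot_le
      (fun h => hY (isSubquotient_of_map_eq hfY hfY_eq h)) hc (fun g a => ?_) fun g hg a => ?_
    all_goals
      obtain ⟨v, rfl⟩ := mkMap_surjective Y X a
      rw [hc_mk]
    · exact hH.sub_mem_of_map_eq hPρ hPτ hf hYX hfX_eq hfY_eq g v.2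
    · have h : f (ρ g (ρ g⁻¹ v)) = τ g (f (ρ g⁻¹ v)) := hf.isIntertwining ⟨g, hg⟩ _
      rw [← h, ρ.self_inv_apply, sub_self]
      exact Submodule.zero_mem _
  have h : c g (mkMap Y X ⟨ρ g v, X.apply_mem_toSubmodule g hv⟩) = 0 := hc0 g _
  rw [hc_mk, ρ.inv_self_apply] at h
  exact (sub_eq_zero.1 h).symm

theorem IsKummerChain.isIntertwiningMap [FiniteDimensional k W] (hH : IsKummerChain χ P H m)
    (hPρ : TrivialOnFactors P ρ) (hPτ : TrivialOnFactors P τ) {s : CompSeries ρ}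
    (hs : s.IsTwistFree χ) {t : CompSeries τ} (ht : t.IsTwistFree χ)
    (hf : Representation.IsIntertwiningMap (restrict ρ (H m)) (restrict τ (H m)) f) :
    Representation.IsIntertwiningMap ρ τ f := by
  suffices ∀ i, ∀ g, ∀ v ∈ s.sub i, f (ρ g v) = τ g (f v) from
    ⟨fun g v => this 0 g v (by rw [s.sub_zero]; trivial)⟩
  intro i
  induction i using Fin.reverseInduction with
  | last =>
    intro g v hv
    rw [s.sub_last] at hv
    simp [show v = 0 from hv]
  | cast i ih =>
    exact fun g v hv => hH.apply_eq_of_covBy hPρ hPτ (hH.invtSubmodule_restrict_le hPτ ht) hf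
      (s.covBy i) (hs i) ih g hv

end Equivariance

section PGroups

variable {p : ℕ} [Fact p.Prime]

theorem exists_ne_zero_forall_smul_eq_of_finite {Q A : Type*} [Group Q] (hQ : IsPGroup p Q)
    [AddCommGroup A] [Nontrivial A] [Finite A] [DistribMulAction Q A] (hA : ∀ a : A, p • a = 0) :
    ∃ b : A, b ≠ 0 ∧ ∀ g : Q, g • b = b := by
  obtain ⟨a, ha⟩ := exists_ne (0 : A)
  have hcard : p ∣ Nat.card A := by
    rw [← addOrderOf_eq_prime (hA a) ha]
    exact addOrderOf_dvd_natCard a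
  obtain ⟨b, hb, hb0⟩ := hQ.exists_fixed_point_of_prime_dvd_card_of_fixed_point A hcard (a := 0)
    fun g => smul_zero g
  exact ⟨b, hb0.symm, hb⟩

/-- The orbit of a nonzero vector spans a finite stable subgroup, which reduces to the case of a
finite module. -/
theorem exists_ne_zero_forall_smul_eq {Q A : Type*} [Group Q] [Finite Q]
    (hQ : IsPGroup p Q) [AddCommGroup A] [Nontrivial A] [DistribMulAction Q A]
    (hA : ∀ a : A, p • a = 0) : ∃ b : A, b ≠ 0 ∧ ∀ g : Q, g • b = b := by
  obtain ⟨a, ha⟩ := exists_ne (0 : A)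
  let S : AddSubgroup A := AddSubgroup.closure (MulAction.orbit Q a)
  have hS : ∀ g : Q, ∀ b ∈ S, g • b ∈ S := fun g b hb => by
    have hle : S ≤ S.comap (DistribSMul.toAddMonoidHom A g) :=
      (AddSubgroup.closure_le _).2 fun c hc =>
        AddSubgroup.subset_closure (MulAction.mem_orbit_of_mem_orbit g hc)
    exact hle hb
  have hpS : ∀ b : S, p • b = 0 := fun b => Subtype.ext (hA b)
  have : Finite (MulAction.orbit Q a) := Set.finite_range _
  have : AddGroup.FG S := AddGroup.closure_finite_fg _
  have : Finite S := AddCommGroup.finite_of_fg_isAddTorsion _ fun b =>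
    isOfFinAddOrder_iff_nsmul_eq_zero.2 ⟨p, (Fact.out : p.Prime).pos, hpS b⟩
  have : Nontrivial S :=
    ⟨⟨a, AddSubgroup.subset_closure (MulAction.mem_orbit_self a)⟩, 0, fun h =>
      ha (congrArg Subtype.val h)⟩
  let _ : DistribMulAction Q S :=
    { smul := fun g b => ⟨g • (b : A), hS g b b.2⟩
      one_smul := fun b => Subtype.ext (one_smul Q (b : A))
      mul_smul := fun g h b => Subtype.ext (mul_smul g h (b : A))
      smul_zero := fun g => Subtype.ext (smul_zero g)
      smul_add := fun g b c => Subtype.ext (smul_add g (b : A) c) }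
  obtain ⟨b, hb, hfix⟩ := exists_ne_zero_forall_smul_eq_of_finite hQ hpS
  exact ⟨b, fun h => hb (Subtype.ext h), fun g => congrArg Subtype.val (hfix g)⟩

variable {k G A W : Type*} [Field k] [CharP k p] [Group G] [AddCommGroup A] [Module k A]
  [AddCommGroup W] [Module k W]

theorem invariants_ne_bot [Nontrivial A] (α : Representation k G A)
    [(MonoidHom.ker α).FiniteIndex] (hp : ∀ g, ∃ n : ℕ, g ^ p ^ n ∈ MonoidHom.ker α) :
    α.invariants ≠ ⊥ := by
  let _ : DistribMulAction (G ⧸ MonoidHom.ker α) A :=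
    DistribMulAction.compHom A
      (QuotientGroup.lift (MonoidHom.ker α) α (M := Module.End k A) fun _ hg => hg)
  have hQ : IsPGroup p (G ⧸ MonoidHom.ker α) := fun g => by
    induction g using QuotientGroup.induction_on with
    | H g =>
      obtain ⟨n, hn⟩ := hp g
      exact ⟨n, (QuotientGroup.eq_one_iff _).2 hn⟩
  obtain ⟨b, hb, hfix⟩ := exists_ne_zero_forall_smul_eq (p := p) hQ (A := A) fun a => by
    rw [← Nat.cast_smul_eq_nsmul k, CharP.cast_eq_zero, zero_smul]
  exact (Submodule.ne_bot_iff _).2 ⟨b, fun g => hfix g, hb⟩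

theorem eq_one_of_isIrreducible (α : Representation k G A) [hα : α.IsIrreducible]
    [(MonoidHom.ker α).FiniteIndex] {P : Subgroup G} [P.Normal]
    (hP : ∀ x ∈ P, ∃ n : ℕ, x ^ p ^ n ∈ MonoidHom.ker α) {x : G} (hx : x ∈ P) : α x = 1 := by
  have : Nontrivial A := by
    by_contra! h
    exact bot_ne_top (α := Subrepresentation α)
      (Subrepresentation.toSubmodule_injective (Subsingleton.elim _ _))
  have : (MonoidHom.ker (restrict α P)).FiniteIndex :=
    inferInstanceAs ((MonoidHom.ker α).subgroupOf P).FiniteIndex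
  let F : Subrepresentation α :=
    ⟨(restrict α P).invariants, fun g _ hv => α.le_comap_invariants P g hv⟩
  have hF : F ≠ ⊥ := fun h => invariants_ne_bot (p := p) (restrict α P) (fun x => hP x x.2)
    (congrArg Subrepresentation.toSubmodule h)
  have htop : F = ⊤ := (eq_bot_or_eq_top F).resolve_left hF
  ext v
  exact (htop ▸ Submodule.mem_top : v ∈ F.toSubmodule) ⟨x, hx⟩

theorem ker_le_ker_subquotient {ρ : Representation k G W} (Y X : Subrepresentation ρ) :
    MonoidHom.ker ρ ≤ MonoidHom.ker (subquotient Y X) := fun g hg => by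
  ext v
  exact congrArg (mkMap Y X) (Subtype.ext (LinearMap.congr_fun hg (v : W)) :
    X.toRepresentation g v = v)

theorem trivialOnFactors_of_pow_mem_ker (ρ : Representation k G W)
    [(MonoidHom.ker ρ).FiniteIndex] {P : Subgroup G} [P.Normal]
    (hP : ∀ x ∈ P, ∃ n : ℕ, x ^ p ^ n ∈ MonoidHom.ker ρ) : TrivialOnFactors P ρ := by
  intro Y X h x hx v hv
  have hker := ker_le_ker_subquotient Y X
  have := (isIrreducible_subquotient_iff h.le).2 h
  have := Subgroup.finiteIndex_of_le hker
  have hone : subquotient Y X x = 1 :=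
    eq_one_of_isIrreducible (p := p) _ (fun x hx => (hP x hx).imp fun _ hn => hker hn) hx
  exact mkMap_eq_iff.1 (LinearMap.congr_fun hone (mkMap Y X ⟨v, hv⟩))

end PGroups

section CosetTransversal

variable {Γ : Type*} [Group Γ] {J : Subgroup Γ}

theorem out_smul_eq_smul {X : Type*} [MulAction Γ X] {z : X} (hz : ∀ j ∈ J, j • z = z) (g : Γ) :
    (QuotientGroup.mk g : Γ ⧸ J).out • z = g • z := by
  obtain ⟨j, hj⟩ := QuotientGroup.mk_out_eq_mul J g
  rw [hj, mul_smul, hz j j.2]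

theorem smul_out_smul {X : Type*} [MulAction Γ X] {z : X} (hz : ∀ j ∈ J, j • z = z) (g : Γ)
    (q : Γ ⧸ J) : g • q.out • z = (g • q).out • z := by
  conv_rhs => rw [← QuotientGroup.out_eq' q, MulAction.Quotient.smul_mk, out_smul_eq_smul hz]
  exact (mul_smul g q.out z).symm

variable [Fintype (Γ ⧸ J)]

theorem smul_sum_out_smul {X : Type*} [AddCommMonoid X] [DistribMulAction Γ X] {z : X}
    (hz : ∀ j ∈ J, j • z = z) (g : Γ) :
    g • ∑ q : Γ ⧸ J, q.out • z = ∑ q : Γ ⧸ J, q.out • z := by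
  rw [Finset.smul_sum]
  exact Fintype.sum_equiv (MulAction.toPerm g) _ _ fun q => smul_out_smul hz g q

theorem smul_prod_out_smul {X : Type*} [CommMonoid X] [MulDistribMulAction Γ X] {z : X}
    (hz : ∀ j ∈ J, j • z = z) (g : Γ) :
    g • ∏ q : Γ ⧸ J, q.out • z = ∏ q : Γ ⧸ J, q.out • z := by
  rw [Finset.smul_prod']
  exact Fintype.prod_equiv (MulAction.toPerm g) _ _ fun q => smul_out_smul hz g q

theorem exists_sum_out_smul_ne_zero {κ : Type*} [Field κ] [MulSemiringAction Γ κ]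
    (hJ : ∀ g : Γ, (∀ ξ : κ, g • ξ = ξ) → g ∈ J) : ∃ ξ : κ, ∑ q : Γ ⧸ J, q.out • ξ ≠ 0 := by
  let Φ : Γ ⧸ J → κ →* κ := fun q => MulSemiringAction.toRingHom Γ κ q.out
  have hΦ : Function.Injective Φ := fun q r hqr => by
    rw [← QuotientGroup.out_eq' q, ← QuotientGroup.out_eq' r]
    refine QuotientGroup.eq.2 (hJ _ fun ξ => ?_)
    rw [mul_smul, inv_smul_eq_iff]
    exact (DFunLike.congr_fun hqr ξ).symm
  have hindep : LinearIndependent κ fun q => (Φ q : κ → κ) :=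
    (linearIndependent_monoidHom κ κ).comp Φ hΦ
  by_contra! h
  refine one_ne_zero (Fintype.linearIndependent_iff.1 hindep (fun _ => (1 : κ)) ?_
    (QuotientGroup.mk 1))
  ext ξ
  simpa [Φ] using h ξ

end CosetTransversal

section LocalRing

open IsLocalRing

variable {p : ℕ} [Fact p.Prime] {R Γ : Type*} [CommRing R] [IsLocalRing R] [Group Γ]
  [MulSemiringAction Γ R]

theorem mem_inertia_maximalIdeal_iff {g : Γ} :
    g ∈ (maximalIdeal R).inertia Γ ↔ ∀ ξ : ResidueField R, g • ξ = ξ := by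
  rw [residue_surjective.forall]
  refine forall_congr' fun x => ?_
  rw [← ResidueField.residue_smul, ← sub_eq_zero, ← map_sub, residue_eq_zero_iff]
  rfl

theorem exists_isUnit_sum_out_smul [Finite Γ] [CharP (ResidueField R) p]
    (hJ : IsPGroup p ((maximalIdeal R).inertia Γ)) [Fintype (Γ ⧸ (maximalIdeal R).inertia Γ)] :
    ∃ y : R, (∀ j ∈ (maximalIdeal R).inertia Γ, j • y = y) ∧
      IsUnit (∑ q : Γ ⧸ (maximalIdeal R).inertia Γ, q.out • y) := by
  classical
  let J := (maximalIdeal R).inertia Γ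
  let _ := Fintype.ofFinite J
  obtain ⟨a, ha⟩ : ∃ a, Nat.card J = p ^ a := hJ.exists_card_eq
  obtain ⟨ξ, hξ⟩ := exists_sum_out_smul_ne_zero (κ := ResidueField R) (J := J)
    fun g => mem_inertia_maximalIdeal_iff.2
  obtain ⟨x, rfl⟩ := residue_surjective ξ
  refine ⟨∏ j : J, (j : Γ) • x, fun j hj => ?_, ?_⟩
  · simp only [Finset.smul_prod', ← mul_smul]
    exact Fintype.prod_equiv (Equiv.mulLeft (⟨j, hj⟩ : J)) _ _ fun i => rfl
  · have hres : residue R (∏ j : J, (j : Γ) • x) = residue R x ^ p ^ a := by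
      have hfix : ∀ j : J, (j : Γ) • residue R x = residue R x := fun j =>
        mem_inertia_maximalIdeal_iff.1 j.2 _
      rw [map_prod, ← ha, Nat.card_eq_fintype_card]
      simp only [ResidueField.residue_smul, hfix, Finset.prod_const, Finset.card_univ]
    rw [← not_not (a := IsUnit _), ← mem_nonunits_iff, ← mem_maximalIdeal, ← residue_eq_zero_iff]
    simp only [map_sum, ResidueField.residue_smul, hres, smul_pow', ← sum_pow_char_pow]
    exact pow_ne_zero _ hξ

end LocalRing

section Valued

open IsLocalRing

variable {L Γ Γ₀ : Type*} [Field L] [Group Γ] [MulSemiringAction Γ L]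
  [LinearOrderedCommGroupWithZero Γ₀] {v : Valuation L Γ₀}

/-- The wild inertia group: the elements acting trivially on the graded pieces of the valuation
filtration. -/
def wildInertia (v : Valuation L Γ₀) (hv : ∀ (g : Γ) x, v (g • x) = v x) : Subgroup Γ where
  carrier := {g | ∀ x, x ≠ 0 → v (g • x - x) < v x}
  one_mem' x hx := by simpa [zero_lt_iff] using hx
  mul_mem' {g h} hg hh x hx := by
    have hsplit : (g * h) • x - x = g • (h • x - x) + (g • x - x) := by
      rw [smul_sub, mul_smul, sub_add_sub_cancel]
    rw [hsplit]
    exact v.map_add_lt ((hv g _).trans_lt (hh x hx)) (hg x hx)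
  inv_mem' {g} hg x hx := by
    have hinv : g⁻¹ • x - x = -(g⁻¹ • (g • x - x)) := by
      rw [smul_sub, inv_smul_smul, neg_sub]
    rw [hinv, Valuation.map_neg, hv]
    exact hg x hx

/-- The action on the ring of integers induced by an action preserving the valuation. -/
abbrev integerAction (v : Valuation L Γ₀) (hv : ∀ (g : Γ) x, v (g • x) = v x) :
    MulSemiringAction Γ v.valuationSubring where
  smul g x := ⟨g • (x : L), (hv g x).trans_le x.2⟩
  one_smul x := Subtype.ext (one_smul Γ (x : L))
  mul_smul g h x := Subtype.ext (mul_smul g h (x : L))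
  smul_zero g := Subtype.ext (smul_zero g)
  smul_add g x y := Subtype.ext (smul_add g (x : L) y)
  smul_one g := Subtype.ext (smul_one g)
  smul_mul g x y := Subtype.ext (smul_mul' g (x : L) y)

/-- The inertia group: the elements acting trivially on the residue field. -/
def inertiaSubgroup (v : Valuation L Γ₀) (hv : ∀ (g : Γ) x, v (g • x) = v x) : Subgroup Γ :=
  let _ := integerAction v hv
  (maximalIdeal v.valuationSubring).inertia Γ

variable {hv : ∀ (g : Γ) x, v (g • x) = v x}

theorem mem_inertiaSubgroup {g : Γ} :
    g ∈ inertiaSubgroup v hv ↔ ∀ x, v x ≤ 1 → v (g • x - x) < 1 :=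
  ⟨fun h x hx => (Valuation.mem_maximalIdeal_iff _ _).1 (h ⟨x, hx⟩),
    fun h x => (Valuation.mem_maximalIdeal_iff _ _).2 (h x x.2)⟩

instance wildInertia_normal : (wildInertia v hv).Normal where
  conj_mem g hg h x hx := by
    have hconj : (h * g * h⁻¹) • x - x = h • (g • (h⁻¹ • x) - h⁻¹ • x) := by
      rw [smul_sub, smul_inv_smul, mul_smul, mul_smul]
    rw [hconj, hv, ← hv h⁻¹ x]
    exact hg _ ((smul_ne_zero_iff_ne h⁻¹).2 hx)

theorem valuation_natCast_le_one (v : Valuation L Γ₀) (n : ℕ) : v (n : L) ≤ 1 :=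
  natCast_mem v.integer n

theorem valuation_natCast_eq_one {p r : ℕ} (hp : v (p : L) < 1) (hr : p.Coprime r) :
    v (r : L) = 1 := by
  refine (valuation_natCast_le_one v r).antisymm (not_lt.1 fun hlt => ?_)
  obtain ⟨a, b, hab⟩ := Nat.isCoprime_iff_coprime.2 hr
  have hbezout : (a : L) * p + b * r = 1 := by exact_mod_cast congrArg (Int.cast : ℤ → L) hab
  refine (v.map_add_lt (x := (a : L) * p) (y := b * r) (g := 1) ?_ ?_).ne (by rw [hbezout, map_one])
  · rw [map_mul]
    exact mul_lt_one_of_nonneg_of_lt_one_right (intCast_mem v.integer a) zero_le hp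
  · rw [map_mul]
    exact mul_lt_one_of_nonneg_of_lt_one_right (intCast_mem v.integer b) zero_le hlt

/-- If `y = g • x - x` is nonzero, then `∑ i < r, g ^ i • y` has the same valuation as `r * y`,
but the sum telescopes to `0`. -/
theorem smul_eq_of_pow_eq_one {g : Γ} (hg : g ∈ wildInertia v hv) {r : ℕ} (hgr : g ^ r = 1)
    (hr : v (r : L) = 1) (x : L) : g • x = x := by
  by_contra hne
  have hy : g • x - x ≠ 0 := sub_ne_zero.2 hne
  have htelescope : ∑ i ∈ Finset.range r, g ^ i • (g • x - x) = 0 := by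
    simp only [smul_sub, ← mul_smul, ← pow_succ]
    rw [Finset.sum_range_sub (fun i => g ^ i • x), hgr, pow_zero, sub_self]
  have hlt : v (∑ i ∈ Finset.range r, (g ^ i • (g • x - x) - (g • x - x))) < v (g • x - x) :=
    v.map_sum_lt (v.ne_zero_iff.2 hy) fun i _ => (wildInertia v hv).pow_mem hg i _ hy
  rw [Finset.sum_sub_distrib, htelescope, zero_sub, Valuation.map_neg, Finset.sum_const,
    Finset.card_range, nsmul_eq_mul, map_mul, hr, one_mul] at hlt
  exact lt_irrefl _ hlt

variable {p : ℕ} [hpp : Fact p.Prime]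

theorem isPGroup_wildInertia [Finite Γ] [FaithfulSMul Γ L] (hp : v (p : L) < 1) :
    IsPGroup p (wildInertia v hv) := by
  rintro ⟨g, hg⟩
  obtain ⟨k, r, hr, hkr⟩ := Nat.exists_eq_pow_mul_and_not_dvd
    (isOfFinOrder_of_finite g).orderOf_pos.ne' p hpp.out.ne_one
  have hgr : (g ^ p ^ k) ^ r = 1 := by rw [← pow_mul, ← hkr, pow_orderOf_eq_one]
  refine ⟨k, Subtype.ext (FaithfulSMul.eq_of_smul_eq_smul fun x : L => ?_)⟩
  exact (smul_eq_of_pow_eq_one ((wildInertia v hv).pow_mem hg _) hgr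
    (valuation_natCast_eq_one hp ((hpp.out.coprime_iff_not_dvd).2 hr)) x).trans (one_smul Γ x).symm

theorem charP_residueField (hp : v (p : L) < 1) : CharP (ResidueField v.valuationSubring) p := by
  refine (CharP.charP_iff_prime_eq_zero hpp.out).2 ?_
  rw [← map_natCast (residue v.valuationSubring), residue_eq_zero_iff,
    Valuation.mem_maximalIdeal_iff]
  simpa using hp

theorem residue_eq_residue_iff (x y : v.valuationSubring) :
    residue v.valuationSubring x = residue v.valuationSubring y ↔ v ((x : L) - y) < 1 := by
  rw [← sub_eq_zero, ← map_sub, residue_eq_zero_iff, Valuation.mem_maximalIdeal_iff]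
  rfl

theorem valuation_sub_one_lt_one_of_pow (hp : v (p : L) < 1) {c : L} (hc : v c ≤ 1) {k : ℕ}
    (h : v (c ^ p ^ k - 1) < 1) : v (c - 1) < 1 := by
  have := charP_residueField hp
  let c' : v.valuationSubring := ⟨c, hc⟩
  have hpow := (residue_eq_residue_iff (c' ^ p ^ k) (1 ^ p ^ k)).2 (by simpa using h)
  rw [map_pow, map_pow] at hpow
  simpa using (residue_eq_residue_iff c' 1).1 (iterateFrobenius_inj _ p k hpow)

theorem valuation_smul_div_self {x : L} (hx : x ≠ 0)
    (hv : ∀ (g : Γ) x, v (g • x) = v x) (g : Γ) : v (g • x / x) = 1 := by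
  rw [map_div₀, hv, div_self (v.ne_zero_iff.2 hx)]

theorem valuation_smul_sub_lt_iff {x : L} (hx : x ≠ 0) {g : Γ} :
    v (g • x - x) < v x ↔ v (g • x / x - 1) < 1 := by
  rw [div_sub_one hx, map_div₀, div_lt_one₀ (zero_lt_iff.2 (v.ne_zero_iff.2 hx))]

theorem valuation_smul_sub_lt_of_smul_pow_eq (hp : v (p : L) < 1)
    (hv : ∀ (g : Γ) x, v (g • x) = v x) {x : L} (hx : x ≠ 0) {g : Γ} {k : ℕ}
    (h : (g • x) ^ p ^ k = x ^ p ^ k) : v (g • x - x) < v x := by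
  refine (valuation_smul_sub_lt_iff hx).2 (valuation_sub_one_lt_one_of_pow hp
    (valuation_smul_div_self hx hv g).le (k := k) ?_)
  rw [div_pow, h, div_self (pow_ne_zero _ hx), sub_self, map_zero]
  exact zero_lt_one

theorem valuation_pow_smul_div_sub_lt_one {g : Γ} (hg : g ∈ inertiaSubgroup v hv) {x : L}
    (hx : x ≠ 0) (n : ℕ) : v (g ^ n • x / x - (g • x / x) ^ n) < 1 := by
  have hunit := valuation_smul_div_self hx hv
  induction n with
  | zero => simp [hx]
  | succ n ih =>
    have hgx : g • x ≠ 0 := (smul_ne_zero_iff_ne g).2 hx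
    have hsplit : g ^ (n + 1) • x / x - (g • x / x) ^ (n + 1) =
        (g • (g ^ n • x / x) - g ^ n • x / x) * (g • x / x) +
          (g ^ n • x / x - (g • x / x) ^ n) * (g • x / x) := by
      rw [smul_div₀', ← mul_smul, ← pow_succ', ← div_mul_div_cancel₀ (c := x) hgx]
      ring
    rw [hsplit]
    refine v.map_add_lt ?_ ?_
    · rw [map_mul, hunit, mul_one]
      exact mem_inertiaSubgroup.1 hg _ (hunit _).le
    · rwa [map_mul, hunit, mul_one]

/-- On inertia, `g ↦ g • x / x` is multiplicative modulo the maximal ideal, and the residue field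
has no nontrivial `p`-power roots of unity. -/
theorem inertiaSubgroup_le_wildInertia (hΓ : IsPGroup p Γ) (hp : v (p : L) < 1) :
    inertiaSubgroup v hv ≤ wildInertia v hv := by
  intro g hg x hx
  obtain ⟨k, hk⟩ := hΓ g
  have hpow := valuation_pow_smul_div_sub_lt_one hg hx (p ^ k)
  rw [hk, one_smul, div_self hx, Valuation.map_sub_swap] at hpow
  exact (valuation_smul_sub_lt_iff hx).2
    (valuation_sub_one_lt_one_of_pow hp (valuation_smul_div_self hx hv g).le hpow)

theorem exists_valuation_sum_out_smul_eq_one [Finite Γ] (hΓ : IsPGroup p (inertiaSubgroup v hv))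
    (hp : v (p : L) < 1) [Fintype (Γ ⧸ inertiaSubgroup v hv)] :
    ∃ y : L, v y ≤ 1 ∧ (∀ j ∈ inertiaSubgroup v hv, j • y = y) ∧
      v (∑ q : Γ ⧸ inertiaSubgroup v hv, q.out • y) = 1 := by
  let _ := integerAction v hv
  let _ : Fintype (Γ ⧸ (maximalIdeal v.valuationSubring).inertia Γ) :=
    ‹Fintype (Γ ⧸ inertiaSubgroup v hv)›
  have := charP_residueField hp
  obtain ⟨y, hy, hunit⟩ := exists_isUnit_sum_out_smul (R := v.valuationSubring) hΓ
  refine ⟨y, y.2, fun j hj => congrArg Subtype.val (hy j hj), ?_⟩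
  let z : v.valuationSubring :=
    ∑ q : Γ ⧸ (maximalIdeal v.valuationSubring).inertia Γ, q.out • y
  have hcoe : ∑ q : Γ ⧸ inertiaSubgroup v hv, q.out • (y : L) = z :=
    (map_sum v.valuationSubring.subtype
      (fun q : Γ ⧸ (maximalIdeal v.valuationSubring).inertia Γ => q.out • y) Finset.univ).symm
  rw [hcoe]
  refine le_antisymm z.2 (not_lt.1 fun hlt => ?_)
  exact (Valuation.mem_maximalIdeal_iff _ _).2 hlt hunit

theorem exists_fixed_valuation_eq [Finite Γ] (hΓ : IsPGroup p Γ) (hp : v (p : L) < 1) {α : L}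
    (hα : ∀ g : Γ, v (g • α - α) < v α) (hJ : ∀ j ∈ inertiaSubgroup v hv, j • α = α) :
    ∃ a : L, (∀ g : Γ, g • a = a) ∧ v a = v α := by
  let _ := Fintype.ofFinite (Γ ⧸ inertiaSubgroup v hv)
  obtain ⟨y, hy, hyJ, hsum⟩ := exists_valuation_sum_out_smul_eq_one (hΓ.to_subgroup _) hp
  refine ⟨∑ q : Γ ⧸ inertiaSubgroup v hv, q.out • (y * α), smul_sum_out_smul fun j hj => by
    rw [smul_mul', hyJ j hj, hJ j hj], ?_⟩
  have hsplit : ∑ q : Γ ⧸ inertiaSubgroup v hv, q.out • (y * α) =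
      (∑ q : Γ ⧸ inertiaSubgroup v hv, q.out • y) * α +
        ∑ q : Γ ⧸ inertiaSubgroup v hv, (q.out • y) * (q.out • α - α) := by
    rw [Finset.sum_mul, ← Finset.sum_add_distrib]
    exact Finset.sum_congr rfl fun q _ => by rw [smul_mul']; ring
  have hmain : v ((∑ q : Γ ⧸ inertiaSubgroup v hv, q.out • y) * α) = v α := by
    rw [map_mul, hsum, one_mul]
  have hα0 : v α ≠ 0 := (zero_le.trans_lt (hα 1)).ne'
  have herror : v (∑ q : Γ ⧸ inertiaSubgroup v hv, (q.out • y) * (q.out • α - α)) < v α :=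
    v.map_sum_lt hα0 fun q _ => by
      rw [map_mul, hv]
      exact (mul_le_of_le_one_left zero_le hy).trans_lt (hα _)
  rw [hsplit, v.map_add_eq_of_lt_left (herror.trans_eq hmain.symm), hmain]

theorem exists_fixed_valuation_eq_pow_index [Finite Γ] {S : Subgroup Γ}
    (hv : ∀ (g : Γ) x, v (g • x) = v x) {a : L} (ha : ∀ g ∈ S, g • a = a) :
    ∃ b : L, (∀ g : Γ, g • b = b) ∧ v b = v a ^ S.index := by
  let _ := Fintype.ofFinite (Γ ⧸ S)
  refine ⟨∏ q : Γ ⧸ S, q.out • a, smul_prod_out_smul ha, ?_⟩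
  simp only [map_prod, hv, Finset.prod_const, Finset.card_univ, Subgroup.index,
    Nat.card_eq_fintype_card]

/-- Otherwise, over a Sylow `p`-subgroup of `Δ`, the ramification carried by `α` would be tame,
hence trivial: `v α` would be the valuation of a fixed element, whose norm down to `Γ` has
valuation `v α` to a power not divisible by `p ^ n`. -/
theorem exists_wildInertia_smul_ne [Finite Γ] (hp : v (p : L) < 1) {Δ : Subgroup Γ} {α : L}
    (hα0 : α ≠ 0) (hα : ∀ g ∈ Δ, (g • α) ^ p = α ^ p) {n : ℕ} (hΔ : ¬ p ^ n ∣ Δ.index)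
    (hval : ∀ (x : L) (r : ℕ), (∀ g : Γ, g • x = x) → v x = v α ^ r → p ^ n ∣ r) :
    ∃ g ∈ wildInertia v hv ⊓ Δ, g • α ≠ α := by
  by_contra! hfix
  obtain ⟨S⟩ : Nonempty (Sylow p Δ) := inferInstance
  let S' : Subgroup Γ := (S : Subgroup Δ).map Δ.subtype
  have hS'Δ : S' ≤ Δ := Subgroup.map_subtype_le _
  have hS'p : IsPGroup p S' := S.isPGroup'.map _
  have hvS : ∀ (g : S') x, v (g • x) = v x := fun g x => hv g x
  have hinertia : ∀ g ∈ inertiaSubgroup v hvS, g • α = α := fun g hg =>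
    hfix g ⟨inertiaSubgroup_le_wildInertia hS'p hp hg, hS'Δ g.2⟩
  have hlt : ∀ g : S', v (g • α - α) < v α := fun g =>
    valuation_smul_sub_lt_of_smul_pow_eq hp hvS hα0 (k := 1)
      (by rw [pow_one]; exact hα g (hS'Δ g.2))
  obtain ⟨a, ha, hva⟩ := exists_fixed_valuation_eq hS'p hp hlt hinertia
  obtain ⟨b, hb, hvb⟩ := exists_fixed_valuation_eq_pow_index (S := S') hv fun g hg => ha ⟨g, hg⟩
  have hdvd : p ^ n ∣ (S : Subgroup Δ).index * Δ.index := by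
    rw [← Subgroup.index_map_subtype]
    exact hval b _ hb (hvb.trans (by rw [hva]))
  exact hΔ (((hpp.out.coprime_iff_not_dvd.2 S.not_dvd_index).pow_left n).dvd_of_dvd_mul_left hdvd)

end Valued

section PadicValuation

theorem exists_valuation_eq_zpow_of_irreducible {F Γ₀ O : Type*} [Field F]
    [LinearOrderedCommGroupWithZero Γ₀] {v : Valuation F Γ₀} [CommRing O] [IsDomain O]
    [IsDiscreteValuationRing O] [Algebra O F] (hv : v.Integers O) {π : O}
    (hπ : Irreducible π) {x : F} (hx : x ≠ 0) : ∃ n : ℤ, v x = v (algebraMap O F π) ^ n := by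
  have := hv.isFractionRing
  obtain ⟨n, u, rfl⟩ := IsDiscreteValuationRing.exists_units_eq_smul_zpow_of_irreducible hπ hx
  refine ⟨n, ?_⟩
  rw [Units.smul_def, Algebra.smul_def, map_mul, map_zpow₀, hv.valuation_unit, one_mul]

variable (p : ℕ) [Fact p.Prime]

/-- The valuation on an algebraic extension of `ℚ_[p]` extending the `p`-adic one. -/
def padicSpectralValuation (F : Type*) [Field F] [Algebra ℚ_[p] F]
    [Algebra.IsAlgebraic ℚ_[p] F] : Valuation F NNReal where
  toFun x := ⟨spectralNorm ℚ_[p] F x, spectralNorm_nonneg x⟩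
  map_zero' := Subtype.ext spectralNorm_zero
  map_one' := Subtype.ext spectralNorm_one
  map_mul' x y := Subtype.ext (spectralAlgNorm_mul (K := ℚ_[p]) x y)
  map_add_le_max' x y := isNonarchimedean_spectralNorm (K := ℚ_[p]) x y

variable {p} {F : Type*} [Field F] [Algebra ℚ_[p] F] [Algebra.IsAlgebraic ℚ_[p] F]

theorem coe_padicSpectralValuation (x : F) :
    (padicSpectralValuation p F x : ℝ) = spectralNorm ℚ_[p] F x := rfl

theorem padicSpectralValuation_algEquiv (σ : F ≃ₐ[ℚ_[p]] F) (x : F) :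
    padicSpectralValuation p F (σ x) = padicSpectralValuation p F x :=
  Subtype.ext (spectralNorm_eq_of_equiv σ x).symm

theorem padicSpectralValuation_prime_lt_one : padicSpectralValuation p F (p : F) < 1 := by
  rw [← NNReal.coe_lt_coe, coe_padicSpectralValuation, ← map_natCast (algebraMap ℚ_[p] F),
    spectralNorm_extends]
  exact Padic.norm_p_lt_one

theorem padicSpectralValuation_algebraMap {E : Type*} [Field E] [Algebra ℚ_[p] E]
    [Algebra.IsAlgebraic ℚ_[p] E] [Algebra F E] [IsScalarTower ℚ_[p] F E] (x : F) :
    padicSpectralValuation p E (algebraMap F E x) = padicSpectralValuation p F x :=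
  Subtype.ext (spectralNorm.eq_of_tower (K := ℚ_[p]) (E := F) x).symm

variable [Algebra ℤ_[p] F] [IsScalarTower ℤ_[p] ℚ_[p] F]

theorem isIntegral_iff_padicSpectralValuation_le_one (x : F) :
    IsIntegral ℤ_[p] x ↔ padicSpectralValuation p F x ≤ 1 := by
  have hmonic : (minpoly ℚ_[p] x).Monic :=
    minpoly.monic (Algebra.IsAlgebraic.isAlgebraic x).isIntegral
  rw [← NNReal.coe_le_coe, coe_padicSpectralValuation, NNReal.coe_one, spectralNorm,
    spectralValue_le_one_iff hmonic]
  constructor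
  · intro h n
    rw [minpoly.isIntegrallyClosed_eq_field_fractions' ℚ_[p] h, Polynomial.coeff_map]
    exact PadicInt.norm_le_one _
  · intro h
    have hlift : minpoly ℚ_[p] x ∈ Polynomial.lifts (algebraMap ℤ_[p] ℚ_[p]) := by
      rw [Polynomial.lifts_iff_coeff_lifts]
      exact fun n => ⟨⟨_, h n⟩, rfl⟩
    obtain ⟨q, hq, -, hqm⟩ := Polynomial.lifts_and_degree_eq_and_monic hlift hmonic
    refine ⟨q, hqm, ?_⟩
    rw [← Polynomial.aeval_def, ← Polynomial.aeval_map_algebraMap ℚ_[p], hq, minpoly.aeval]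

theorem padicSpectralValuation_integers :
    (padicSpectralValuation p F).Integers (integralClosure ℤ_[p] F) where
  hom_inj := Subtype.val_injective
  map_le_one x := (isIntegral_iff_padicSpectralValuation_le_one _).1 x.2
  exists_of_le_one x hx := ⟨⟨x, (isIntegral_iff_padicSpectralValuation_le_one x).2 hx⟩, rfl⟩

theorem exists_padicSpectralValuation_eq_zpow [FiniteDimensional ℚ_[p] F]
    {π : integralClosure ℤ_[p] F} (hπ : Irreducible π) {x : F} (hx : x ≠ 0) :
    ∃ n : ℤ, padicSpectralValuation p F x = padicSpectralValuation p F (π : F) ^ n := by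
  have := integralClosure.isDedekindDomain ℤ_[p] ℚ_[p] F
  have hval := ValuationRing.of_integers _ (padicSpectralValuation_integers (p := p) (F := F))
  have hfield : ¬ IsField (integralClosure ℤ_[p] F) := fun h =>
    let _ := h.toField
    hπ.not_isUnit (IsUnit.mk0 π hπ.ne_zero)
  have : IsDiscreteValuationRing (integralClosure ℤ_[p] F) :=
    ((IsDiscreteValuationRing.TFAE _ hfield).out 0 1).2 hval
  exact exists_valuation_eq_zpow_of_irreducible padicSpectralValuation_integers hπ hx

end PadicValuation

section Cyclotomic

variable (p : ℕ) [Fact p.Prime] (K : Type*) [Field K] [Algebra ℚ_[p] K]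

/-- The mod `p` cyclotomic character with values in `\overline{𝔽}_p`. -/
def cycBar : GK K →* Fbar p :=
  (algebraMap (ZMod p) (Fbar p) : ZMod p →* Fbar p).comp
    ((Units.coeHom (ZMod p)).comp (cyc p K))

variable {p K}

theorem cycBar_apply (g : GK K) :
    cycBar p K g = algebraMap (ZMod p) (Fbar p) (cyc p K g : ZMod p) :=
  rfl

theorem natCast_val_cyc (g : GK K) : (((cyc p K g : ZMod p).val : ℕ) : Fbar p) = cycBar p K g := by
  rw [cycBar_apply, ← map_natCast (algebraMap (ZMod p) (Fbar p)), ZMod.natCast_zmod_val]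

theorem apply_eq_pow_cyc (g : GK K) {t : AlgebraicClosure K} (ht : t ^ p = 1) :
    g t = t ^ (cyc p K g : ZMod p).val :=
  modularCyclotomicCharacter.spec (AlgebraicClosure K) (card_rootsOfUnity_algebraicClosure p K)
    (MulSemiringAction.toRingAut (GK K) (AlgebraicClosure K) g)
    (t := Units.ofPowEqOne t p ht (NeZero.ne p))
    ((mem_rootsOfUnity _ _).2 (Units.pow_ofPowEqOne ht (NeZero.ne p)))

theorem apply_eq_of_cyc_eq_one {g : GK K} (hg : cyc p K g = 1) {t : AlgebraicClosure K}
    (ht : t ^ p = 1) : g t = t := by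
  have : Fact (1 < p) := ⟨(Fact.out : p.Prime).one_lt⟩
  rw [apply_eq_pow_cyc g ht, hg, Units.val_one, ZMod.val_one, pow_one]

theorem cyc_eq_one_of_apply_eq {ζ : AlgebraicClosure K} (hζ : IsPrimitiveRoot ζ p) {g : GK K}
    (hg : g ζ = ζ) : cyc p K g = 1 := by
  rw [apply_eq_pow_cyc g hζ.pow_eq_one] at hg
  have hval : (cyc p K g : ZMod p).val = 1 :=
    hζ.pow_inj (ZMod.val_lt _) (Fact.out : p.Prime).one_lt (by rw [hg, pow_one])
  ext
  rw [← ZMod.natCast_zmod_val (cyc p K g : ZMod p), hval, Nat.cast_one, Units.val_one]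

theorem cyc_eq_one_of_cyc_pow_eq_one {g : GK K} {n : ℕ} (hg : cyc p K (g ^ p ^ n) = 1) :
    cyc p K g = 1 := by
  ext
  rw [← ZMod.pow_card_pow (n := n) (cyc p K g : ZMod p), ← Units.val_pow_eq_pow_val, ← map_pow, hg]

theorem IsCyclotomicFree.exists_isTwistFree {V : Type*} [AddCommGroup V] [Module (Fbar p) V]
    [FiniteDimensional (Fbar p) V] {ρ : Representation (Fbar p) (GK K) V}
    (h : IsCyclotomicFree p K ρ) : ∃ s : CompSeries ρ, s.IsTwistFree (cycBar p K) := by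
  obtain ⟨s, hs⟩ := h
  refine ⟨s, fun i hi => hs i ?_⟩
  let e := tprodEquivTwist (χ := cycBar p K) (s.factor i) (γ := Fbar1 p K) fun _ _ => rfl
  have := s.irreducible i
  have := isIrreducible_of_equiv e
  exact (hi.of_equiv e.symm).isJHFactor

end Cyclotomic

section Tower

theorem isOpen_ker_of_isLocallyConstant {G M : Type*} [Group G] [TopologicalSpace G] [Monoid M]
    {ρ : G →* M} (hρ : IsLocallyConstant ρ) : IsOpen (MonoidHom.ker ρ : Set G) :=
  hρ {1}

theorem pow_pow_tower_eq {M : Type*} [Monoid M] {ϖ : ℕ → M} {q : ℕ}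
    (h : ∀ n, ϖ (n + 1) ^ q = ϖ n) (n k : ℕ) : ϖ (n + k) ^ q ^ k = ϖ n := by
  induction k with
  | zero => simp
  | succ k ih => rw [pow_succ', pow_mul, ← add_assoc, h, ih]

variable {K : Type*} [Field K]

/-- The stabilizer in `G_K` of an element of the algebraic closure. -/
def stab (x : AlgebraicClosure K) : Subgroup (GK K) := MulAction.stabilizer (GK K) x

theorem mem_stab {x : AlgebraicClosure K} {g : GK K} : g ∈ stab x ↔ g x = x := Iff.rfl

theorem isOpen_stab (x : AlgebraicClosure K) : IsOpen (stab x : Set (GK K)) :=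
  stabilizer_isOpen_of_isIntegral x

theorem stab_le_stab_pow (x : AlgebraicClosure K) (n : ℕ) : stab x ≤ stab (x ^ n) :=
  fun g hg => by rw [mem_stab, map_pow, mem_stab.1 hg]

theorem mem_GKinf_iff {ϖ : ℕ → AlgebraicClosure K} {g : GK K} :
    g ∈ GKinf ϖ ↔ ∀ n, g ∈ stab (ϖ n) := by
  rw [GKinf, IntermediateField.mem_fixingSubgroup_iff, ← Set.forall_mem_range (p := (g ∈ stab ·))]
  exact IntermediateField.forall_mem_adjoin_smul_eq_self_iff K g

variable [CharZero K]

theorem mem_of_fixingSubgroup_le_stab {L : IntermediateField K (AlgebraicClosure K)}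
    {x : AlgebraicClosure K} (h : L.fixingSubgroup ≤ stab x) : x ∈ L := by
  rw [← InfiniteGalois.fixedField_fixingSubgroup L, IntermediateField.mem_fixedField_iff]
  exact fun g hg => h hg

theorem exists_stab_subset_of_isOpen {q : ℕ} {ϖ : ℕ → AlgebraicClosure K}
    (hϖ : ∀ n, ϖ (n + 1) ^ q = ϖ n) {U : Set (GK K)} (hU : IsOpen U)
    (h : (GKinf ϖ : Set (GK K)) ⊆ U) : ∃ m, (stab (ϖ m) : Set (GK K)) ⊆ U := by
  by_contra! hne
  let T : ℕ → Set (GK K) := fun n => (stab (ϖ n) : Set (GK K)) ∩ Uᶜ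
  have hclosed : ∀ n, IsClosed (T n) := fun n =>
    (Subgroup.isClosed_of_isOpen _ (isOpen_stab (ϖ n))).inter hU.isClosed_compl
  have hanti : ∀ n, T (n + 1) ⊆ T n := fun n =>
    Set.inter_subset_inter_left _ (hϖ n ▸ stab_le_stab_pow (ϖ (n + 1)) q)
  obtain ⟨g, hg⟩ := IsCompact.nonempty_iInter_of_sequence_nonempty_isCompact_isClosed T hanti
    (fun n => Set.not_subset.1 (hne n)) (hclosed 0).isCompact hclosed
  rw [Set.mem_iInter] at hg
  exact (hg 0).2 (h (mem_GKinf_iff.2 fun n => (hg n).1))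

theorem exists_isIntertwiningMap_restrict_stab {q : ℕ} {ϖ : ℕ → AlgebraicClosure K}
    (hϖ : ∀ n, ϖ (n + 1) ^ q = ϖ n) {k V W : Type*} [Field k] [AddCommGroup V] [Module k V]
    [AddCommGroup W] [Module k W] {ρ : Representation k (GK K) V} {τ : Representation k (GK K) W}
    (hρ : IsLocallyConstant ρ) (hτ : IsLocallyConstant τ) {f : V →ₗ[k] W}
    (hf : Representation.IsIntertwiningMap (restrict ρ (GKinf ϖ)) (restrict τ (GKinf ϖ)) f) :
    ∃ m, Representation.IsIntertwiningMap (restrict ρ (stab (ϖ m)))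
      (restrict τ (stab (ϖ m))) f := by
  obtain ⟨m, hm⟩ := exists_stab_subset_of_isOpen hϖ
    (hρ.prodMk hτ {F | f ∘ₗ F.1 = F.2 ∘ₗ f})
    fun g hg => LinearMap.ext fun v => hf.isIntertwining ⟨g, hg⟩ v
  exact ⟨m, ⟨fun g v => LinearMap.congr_fun (hm g.2) v⟩⟩

end Tower

section KummerStep

variable {p : ℕ} [Fact p.Prime] {K : Type*} [Field K]

theorem pow_apply_eq_pow_mul {g : GK K} {ε w : AlgebraicClosure K} (hε : g ε = ε)
    (hw : g w = ε * w) (j : ℕ) : (g ^ j) w = ε ^ j * w := by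
  induction j with
  | zero => simp
  | succ j ih =>
    rw [pow_succ', AlgEquiv.mul_apply, ih, map_mul, map_pow, hε, hw, pow_succ, mul_assoc]

theorem div_pow_eq_one_of_mem_stab_pow {g : GK K} {w : AlgebraicClosure K} {n : ℕ} (hw : w ≠ 0)
    (hg : g ∈ stab (w ^ n)) : (g w / w) ^ n = 1 := by
  rw [div_pow, ← map_pow, mem_stab.1 hg, div_self (pow_ne_zero n hw)]

theorem isPrimitiveRoot_of_pow_prime_eq_one {M : Type*} [CommMonoid M] {ε : M} (hε : ε ^ p = 1)
    (hne : ε ≠ 1) : IsPrimitiveRoot ε p :=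
  orderOf_eq_prime hε hne ▸ IsPrimitiveRoot.orderOf ε

variable [Algebra ℚ_[p] K]

theorem conj_apply_eq {g x : GK K} {ε w : AlgebraicClosure K} (hx : cyc p K x = 1) (hw : w ≠ 0)
    (hε : ε ^ p = 1) (hxw : x w = ε * w) (hg : g ∈ stab (w ^ p)) :
    (g * x * g⁻¹) w = ε ^ (cyc p K g : ZMod p).val * w := by
  obtain ⟨η, hη⟩ : ∃ η, η = g⁻¹ w / w := ⟨_, rfl⟩
  have hηp : η ^ p = 1 := hη ▸ div_pow_eq_one_of_mem_stab_pow hw (inv_mem hg)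
  have hgw : g⁻¹ w = η * w := by rw [hη, div_mul_cancel₀ _ hw]
  have hgη : g (η * w) = w := by
    rw [← hgw, ← AlgEquiv.mul_apply, mul_inv_cancel, AlgEquiv.one_apply]
  rw [AlgEquiv.mul_apply, AlgEquiv.mul_apply, hgw, map_mul x, apply_eq_of_cyc_eq_one hx hηp, hxw,
    mul_left_comm, map_mul g, hgη, apply_eq_pow_cyc g hε]

theorem isKummerStep_stab {P : Subgroup (GK K)} {x : GK K} (hx : cyc p K x = 1)
    {w : AlgebraicClosure K} (hxP : x ∈ P ⊓ stab (w ^ p)) (hxw : x w ≠ w) :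
    IsKummerStep (cycBar p K) P (stab (w ^ p)) (stab w) := by
  have hw : w ≠ 0 := fun h => hxw (by rw [h, map_zero])
  obtain ⟨ε, hε⟩ : ∃ ε, ε = x w / w := ⟨_, rfl⟩
  have hεp : ε ^ p = 1 := hε ▸ div_pow_eq_one_of_mem_stab_pow hw hxP.2
  have hxε : x w = ε * w := by rw [hε, div_mul_cancel₀ _ hw]
  have hprim : IsPrimitiveRoot ε p := isPrimitiveRoot_of_pow_prime_eq_one hεp
    fun h => hxw (by rw [hxε, h, one_mul])
  have hmem : ∀ (j : ℕ) (g : GK K), g w = ε ^ j * w → (x ^ j)⁻¹ * g ∈ stab w := fun j g hg => by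
    rw [mem_stab, AlgEquiv.mul_apply, hg,
      ← pow_apply_eq_pow_mul (apply_eq_of_cyc_eq_one hx hεp) hxε, ← AlgEquiv.mul_apply,
      inv_mul_cancel, AlgEquiv.one_apply]
  refine ⟨x, hxP, fun g hg => ?_, fun g hg => ⟨(cyc p K g : ZMod p).val, natCast_val_cyc g,
    hmem _ _ (conj_apply_eq hx hw hεp hxε hg)⟩⟩
  obtain ⟨j, -, hj⟩ := hprim.eq_pow_of_pow_eq_one (div_pow_eq_one_of_mem_stab_pow hw hg)
  exact ⟨j, hmem j g (by rw [hj, div_mul_cancel₀ _ hw])⟩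

end KummerStep

section Wild

theorem index_stabilizer_le_of_pow_fixed {Γ F : Type*} [Group Γ] [Field F] [MulSemiringAction Γ F]
    {n : ℕ} (hn : 0 < n) {x : F} (hx : ∀ g : Γ, g • x ^ n = x ^ n) :
    (MulAction.stabilizer Γ x).index ≤ n := by
  classical
  have horbit : MulAction.orbit Γ x ⊆ (Polynomial.nthRoots n (x ^ n)).toFinset := by
    rintro _ ⟨g, rfl⟩
    rw [Finset.mem_coe, Multiset.mem_toFinset, Polynomial.mem_nthRoots hn]
    exact (smul_pow' g x n).symm.trans (hx g)
  calc (MulAction.stabilizer Γ x).index = (MulAction.orbit Γ x).ncard :=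
        MulAction.index_stabilizer Γ x
    _ ≤ (Polynomial.nthRoots n (x ^ n)).toFinset.card :=
        Set.ncard_coe_finset _ ▸ Set.ncard_le_ncard horbit (Finset.finite_toSet _)
    _ ≤ n := (Multiset.toFinset_card_le _).trans (Polynomial.card_nthRoots _ _)

variable {p : ℕ} [Fact p.Prime] {K : Type*} [Field K] [Algebra ℚ_[p] K] [FiniteDimensional ℚ_[p] K]

instance : Algebra.IsAlgebraic ℚ_[p] (AlgebraicClosure K) :=
  Algebra.IsAlgebraic.trans ℚ_[p] K (AlgebraicClosure K)

instance (L : IntermediateField K (AlgebraicClosure K)) : Algebra.IsAlgebraic ℚ_[p] L :=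
  Algebra.IsAlgebraic.trans ℚ_[p] K L

variable {L : IntermediateField K (AlgebraicClosure K)}

theorem padicSpectralValuation_smul (L : IntermediateField K (AlgebraicClosure K))
    (g : L ≃ₐ[K] L) (x : L) :
    padicSpectralValuation p L (g • x) = padicSpectralValuation p L x :=
  padicSpectralValuation_algEquiv (g.restrictScalars ℚ_[p]) x

variable (p) in
/-- The elements of `G_K` restricting to the wild inertia of `L / K`. -/
def wildSubgroup (L : IntermediateField K (AlgebraicClosure K)) [Normal K L] : Subgroup (GK K) :=
  (wildInertia (padicSpectralValuation p L) (padicSpectralValuation_smul L)).comap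
    (AlgEquiv.restrictNormalHom L)

instance (L : IntermediateField K (AlgebraicClosure K)) [Normal K L] :
    (wildSubgroup p L).Normal :=
  wildInertia_normal.comap _

theorem exists_pow_mem_fixingSubgroup [Normal K L] [FiniteDimensional K L] {x : GK K}
    (hx : x ∈ wildSubgroup p L) : ∃ n : ℕ, x ^ p ^ n ∈ L.fixingSubgroup := by
  obtain ⟨n, hn⟩ := isPGroup_wildInertia padicSpectralValuation_prime_lt_one
    (⟨_, hx⟩ : wildInertia (padicSpectralValuation p L) (padicSpectralValuation_smul L))
  refine ⟨n, ?_⟩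
  rw [← IntermediateField.restrictNormalHom_ker, MonoidHom.mem_ker, map_pow]
  exact congrArg Subtype.val hn

theorem cyc_eq_one_of_mem_wildSubgroup [Normal K L] [FiniteDimensional K L]
    {ζ : AlgebraicClosure K} (hζ : IsPrimitiveRoot ζ p) (hζL : ζ ∈ L) {x : GK K}
    (hx : x ∈ wildSubgroup p L) : cyc p K x = 1 := by
  obtain ⟨n, hn⟩ := exists_pow_mem_fixingSubgroup hx
  exact cyc_eq_one_of_cyc_pow_eq_one (cyc_eq_one_of_apply_eq hζ
    ((IntermediateField.mem_fixingSubgroup_iff L _).1 hn ζ hζL))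

theorem trivialOnFactors_wildSubgroup [Normal K L] [FiniteDimensional K L] {V : Type*}
    [AddCommGroup V] [Module (Fbar p) V] {ρ : Representation (Fbar p) (GK K) V}
    (hρ : L.fixingSubgroup ≤ MonoidHom.ker ρ) : TrivialOnFactors (wildSubgroup p L) ρ := by
  have : CharP (Fbar p) p :=
    charP_of_injective_algebraMap (algebraMap (ZMod p) (Fbar p)).injective p
  have : L.fixingSubgroup.FiniteIndex :=
    IntermediateField.restrictNormalHom_ker L ▸ Subgroup.finiteIndex_ker _
  have := Subgroup.finiteIndex_of_le hρ
  exact trivialOnFactors_of_pow_mem_ker ρ (p := p) fun x hx =>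
    (exists_pow_mem_fixingSubgroup hx).imp fun n hn => hρ hn

variable [Algebra ℤ_[p] K] [IsScalarTower ℤ_[p] ℚ_[p] K] {π : integralClosure ℤ_[p] K}

theorem dvd_of_padicSpectralValuation_eq_pow [IsGalois K L] [FiniteDimensional K L]
    (hπ : Irreducible π) {α : L} {N : ℕ} (hα : α ^ N = algebraMap K L π) {x : L}
    (hx : ∀ g : L ≃ₐ[K] L, g • x = x) {r : ℕ}
    (hxα : padicSpectralValuation p L x = padicSpectralValuation p L α ^ r) : N ∣ r := by
  have hπα : padicSpectralValuation p L α ^ N = padicSpectralValuation p K (π : K) := by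
    rw [← map_pow, hα, padicSpectralValuation_algebraMap]
  have hπ_lt : padicSpectralValuation p K (π : K) < 1 :=
    padicSpectralValuation_integers.valuation_irreducible_lt_one hπ
  have hα_ne_one : padicSpectralValuation p L α ≠ 1 := fun h => by
    rw [← hπα, h, one_pow] at hπ_lt
    exact hπ_lt.false
  obtain rfl | hN := eq_or_ne N 0
  · exact absurd hπ_lt (by rw [← hπα, pow_zero]; exact lt_irrefl 1)
  have hα_pos : 0 < padicSpectralValuation p L α := by
    rw [← pow_pos_iff hN, hπα]
    exact padicSpectralValuation_integers.valuation_irreducible_pos hπ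
  obtain ⟨y, rfl⟩ := (IsGalois.mem_range_algebraMap_iff_fixed (F := K) x).2 hx
  rw [padicSpectralValuation_algebraMap] at hxα
  have hy : y ≠ 0 := by
    rintro rfl
    exact (pow_pos hα_pos r).ne (by rw [← hxα, map_zero])
  obtain ⟨k, hk⟩ := exists_padicSpectralValuation_eq_zpow hπ hy
  rw [hk, ← hπα, ← zpow_natCast, ← zpow_natCast, ← zpow_mul] at hxα
  exact Int.natCast_dvd_natCast.1 ⟨k, (zpow_right_injective₀ hα_pos hα_ne_one hxα).symm⟩

theorem exists_wildSubgroup_apply_ne [Normal K L] [FiniteDimensional K L] (hπ : Irreducible π)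
    {n : ℕ} {a : AlgebraicClosure K}
    (ha : a ^ p ^ (n + 1) = algebraMap K (AlgebraicClosure K) π) (haL : a ∈ L) :
    ∃ x ∈ wildSubgroup p L ⊓ stab (a ^ p), x a ≠ a := by
  have : CharZero K := charZero_of_injective_algebraMap (algebraMap ℚ_[p] K).injective
  have : IsGalois K L := ⟨⟩
  have hp : 0 < p := (Fact.out : p.Prime).pos
  obtain ⟨α, rfl⟩ : ∃ α : L, (α : AlgebraicClosure K) = a := ⟨⟨a, haL⟩, rfl⟩
  replace ha : α ^ p ^ (n + 1) = algebraMap K L π := Subtype.ext ha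
  have hα : α ≠ 0 := fun h => by
    rw [h, zero_pow (pow_pos hp _).ne', eq_comm, map_eq_zero] at ha
    exact hπ.ne_zero (Subtype.ext ha)
  have hΔ : ¬ p ^ (n + 1) ∣ (MulAction.stabilizer (L ≃ₐ[K] L) (α ^ p)).index := fun hdvd => by
    have hle : (MulAction.stabilizer (L ≃ₐ[K] L) (α ^ p)).index ≤ p ^ n :=
      index_stabilizer_le_of_pow_fixed (pow_pos hp n) fun g => by
        rw [← pow_mul, ← pow_succ', ha, AlgEquiv.smul_def, AlgEquiv.commutes]
    exact ((Nat.le_of_dvd (Nat.pos_of_ne_zero Subgroup.index_ne_zero_of_finite) hdvd).trans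
      hle).not_gt (Nat.pow_lt_pow_succ (Fact.out : p.Prime).one_lt)
  obtain ⟨g, hg, hgα⟩ := exists_wildInertia_smul_ne (hv := padicSpectralValuation_smul L)
    padicSpectralValuation_prime_lt_one hα
    (fun g hg => (smul_pow' g α p).symm.trans hg) hΔ
    fun x r hx hxα => dvd_of_padicSpectralValuation_eq_pow hπ ha hx hxα
  obtain ⟨x, rfl⟩ := AlgEquiv.restrictNormalHom_surjective (F := K) (K₁ := L)
    (AlgebraicClosure K) g
  have hres (y : L) : ((AlgEquiv.restrictNormalHom L x • y : L) : AlgebraicClosure K) = x y :=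
    AlgEquiv.restrictNormal_commutes x L y
  refine ⟨x, ⟨hg.1, ?_⟩, fun h => hgα (Subtype.ext ((hres α).trans h))⟩
  exact mem_stab.2 ((hres (α ^ p)).symm.trans (congrArg Subtype.val hg.2))

theorem isKummerChain_stab [Normal K L] [FiniteDimensional K L] (hπ : Irreducible π)
    {ϖ : ℕ → AlgebraicClosure K} (hϖ_zero : ϖ 0 = algebraMap K (AlgebraicClosure K) π)
    (hϖ_succ : ∀ n, ϖ (n + 1) ^ p = ϖ n) {m : ℕ} (hm : ϖ m ∈ L)
    {ζ : AlgebraicClosure K} (hζ : IsPrimitiveRoot ζ p) (hζL : ζ ∈ L) :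
    IsKummerChain (cycBar p K) (wildSubgroup p L) (fun n => stab (ϖ n)) m where
  zero := by
    refine (Subgroup.eq_top_iff' _).2 fun g => ?_
    rw [mem_stab, hϖ_zero, AlgEquiv.commutes]
  char_eq_one x hx := by
    rw [cycBar_apply, cyc_eq_one_of_mem_wildSubgroup hζ hζL hx, Units.val_one, map_one]
  step n hn := by
    have hpow : ϖ (n + 1) ^ p ^ (n + 1) = algebraMap K (AlgebraicClosure K) π := by
      rw [← hϖ_zero, ← pow_pow_tower_eq hϖ_succ 0 (n + 1), zero_add]
    have hmem : ϖ (n + 1) ∈ L := by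
      rw [← pow_pow_tower_eq hϖ_succ (n + 1) (m - (n + 1)), Nat.add_sub_cancel' hn]
      exact pow_mem hm _
    obtain ⟨x, hx, hne⟩ := exists_wildSubgroup_apply_ne hπ hpow hmem
    simpa only [hϖ_succ] using
      isKummerStep_stab (cyc_eq_one_of_mem_wildSubgroup hζ hζL hx.1) hx hne

end Wild

end CycFree

end

/-- Continuity of a finite-dimensional representation `ρ` over the discrete field
`\overline{𝔽}_p` is expressed as local constancy of `g ↦ ρ g`. -/
theorem mainTheorem4 (p : ℕ) [Fact p.Prime]
    (K : Type*) [Field K] [Algebra ℚ_[p] K] [FiniteDimensional ℚ_[p] K]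
    [Algebra ℤ_[p] K] [IsScalarTower ℤ_[p] ℚ_[p] K]
    (π : integralClosure ℤ_[p] K) (hπ : Irreducible π)
    (ϖ : ℕ → AlgebraicClosure K) (hϖ_zero : ϖ 0 = algebraMap K (AlgebraicClosure K) π)
    (hϖ_succ : ∀ n, ϖ (n + 1) ^ p = ϖ n)
    {V W : Type*} [AddCommGroup V] [Module (CycFree.Fbar p) V]
    [FiniteDimensional (CycFree.Fbar p) V]
    [AddCommGroup W] [Module (CycFree.Fbar p) W] [FiniteDimensional (CycFree.Fbar p) W]
    (ρV : Representation (CycFree.Fbar p) (CycFree.GK K) V) (hρV : IsLocallyConstant ρV)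
    (ρW : Representation (CycFree.Fbar p) (CycFree.GK K) W) (hρW : IsLocallyConstant ρW)
    (hV : CycFree.IsCyclotomicFree p K ρV) (hW : CycFree.IsCyclotomicFree p K ρW)
    (f : V →ₗ[CycFree.Fbar p] W)
    (hf : Representation.IsIntertwiningMap (ρV.comp (CycFree.GKinf ϖ).subtype)
      (ρW.comp (CycFree.GKinf ϖ).subtype) f) :
    Representation.IsIntertwiningMap ρV ρW f := by
  have : CharZero K := charZero_of_injective_algebraMap (algebraMap ℚ_[p] K).injective
  have : NeZero (p : AlgebraicClosure K) := ⟨Nat.cast_ne_zero.2 (Fact.out : p.Prime).ne_zero⟩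
  obtain ⟨s, hs⟩ := hV.exists_isTwistFree
  obtain ⟨t, ht⟩ := hW.exists_isTwistFree
  obtain ⟨m, hm⟩ := CycFree.exists_isIntertwiningMap_restrict_stab hϖ_succ hρV hρW hf
  obtain ⟨ζ, hζ⟩ := HasEnoughRootsOfUnity.exists_primitiveRoot (AlgebraicClosure K) p
  have hopen : IsOpen (((MonoidHom.ker ρV ⊓ MonoidHom.ker ρW) ⊓
      (CycFree.stab (ϖ m) ⊓ CycFree.stab ζ) : Subgroup (CycFree.GK K)) : Set (CycFree.GK K)) :=
    ((CycFree.isOpen_ker_of_isLocallyConstant hρV).inter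
      (CycFree.isOpen_ker_of_isLocallyConstant hρW)).inter
      ((CycFree.isOpen_stab _).inter (CycFree.isOpen_stab _))
  obtain ⟨L, _, _, hL⟩ := (krullTopology_mem_nhds_one_iff_of_normal K (AlgebraicClosure K) _).1
    (hopen.mem_nhds (one_mem _))
  obtain ⟨⟨hLV, hLW⟩, hLϖ, hLζ⟩ := by simpa only [SetLike.coe_subset_coe, le_inf_iff] using hL
  have hchain := CycFree.isKummerChain_stab hπ hϖ_zero hϖ_succ
    (CycFree.mem_of_fixingSubgroup_le_stab hLϖ) hζ (CycFree.mem_of_fixingSubgroup_le_stab hLζ)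
  exact hchain.isIntertwiningMap (CycFree.trivialOnFactors_wildSubgroup hLV)
    (CycFree.trivialOnFactors_wildSubgroup hLW) hs ht hm
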